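/- Fix a prime $p \geq 3$. For $n \geq 1$, let $\Gamma_n(p) = \ker(\mathrm{SL}_n(\mathbb{Z}) \to \mathrm{SL}_n(\mathbb{Z}/p))$ be the level-$p$ principal congruence subgroup, and let $\mathcal{T}_n(\mathbb{Q})$ be the Tits building of $\mathrm{SL}_n(\mathbb{Q})$, i.e. the simplicial complex whose $k$-simplices are the flags $0 \subsetneq V_0 \subsetneq \cdots \subsetneq V_k \subsetneq \mathbb{Q}^n$ of subspaces, on which $\Gamma_n(p) \subset \mathrm{SL}_n(\mathbb{Q})$ acts. Let $t_n$ be the rank of the reduced integral homology group $\widetilde{H}_{n-2}(\mathcal{T}_n(\mathbb{Q})/\Gamma_n(p))$ (where $\widetilde{H}_{-1}(\varnothing) = \mathbb{Z}$), and let $\mathrm{Gr}_k(\mathbb{F}_p^m)$ be the set of $k$-dimensional subspaces of $\mathbb{F}_p^m$. Then $t_1 = 1$, and for all $n \geq 2$, \[t_n = \left(\frac{p-3}{2} + \frac{p-1}{2}\, p^{n-1}\right) t_{n-1} + \frac{(p-1)(p-3)}{4} \sum_{k=1}^{n-2} p^k \cdot |\mathrm{Gr}_k(\mathbb{F}_p^{n-1})|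 \cdot t_k\, t_{n-k-1}.\] -/

import Mathlib

/-! ## Order complexes of posets, modulo a group of order automorphisms

For a poset `P`, the simplices of its order complex (geometric realization) are the finite chains
`x₀ < ⋯ < x_k`.  If a group acts on `P` by order automorphisms, then an element that preserves a
chain fixes each of its members, so the quotient of the order complex is a cell complex with one
(ordered) `k`-simplex for each orbit of `k`-simplices, attached through the faces
`x₀ < ⋯ < x̂_i < ⋯ < x_k`.  Its reduced homology is that of the augmented simplicial chain
complex defined below. -/

/-- A chain `x₀ < ⋯ < x_{j-1}` of `j` elements of `P`, that is, a `(j - 1)`-simplex of the order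
complex of `P`; for `j = 0` it is the empty simplex. -/
abbrev PosetFlag (P : Type*) [PartialOrder P] (j : ℕ) : Type _ := Fin j ↪o P

/-- Omit the `i`-th element of a chain. -/
def PosetFlag.face {P : Type*} [PartialOrder P] {j : ℕ} (i : Fin (j + 1))
    (σ : PosetFlag P (j + 1)) : PosetFlag P j :=
  (Fin.succAboveOrderEmb i).trans σ

section QuotientComplex

variable {G P : Type*} [Group G] [PartialOrder P] (ρ : G →* (P ≃o P))

/-- Two chains are equivalent if some element of the group moves one to the other. -/
def flagSetoid (j : ℕ) : Setoid (PosetFlag P j) where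
  r σ τ := ∃ g : G, ∀ i, ρ g (σ i) = τ i
  iseqv :=
    { refl := fun σ => ⟨1, fun i => by simp⟩
      symm := by
        rintro σ τ ⟨g, h⟩
        refine ⟨g⁻¹, fun i => ?_⟩
        rw [← h i, map_inv]
        exact (ρ g).symm_apply_apply (σ i)
      trans := by
        rintro σ τ υ ⟨g, h⟩ ⟨g', h'⟩
        refine ⟨g' * g, fun i => ?_⟩
        rw [← h' i, ← h i, map_mul]
        rfl }

/-- The `(j - 1)`-simplices of the quotient of the order complex of `P` by the group. -/
def FlagOrbit (j : ℕ) : Type _ := Quotient (flagSetoid ρ j)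

/-- The `i`-th face of a simplex of the quotient. -/
def FlagOrbit.face {j : ℕ} (i : Fin (j + 1)) : FlagOrbit ρ (j + 1) → FlagOrbit ρ j :=
  Quotient.map' (PosetFlag.face i) (by
    rintro σ τ ⟨g, h⟩
    exact ⟨g, fun k => h (i.succAbove k)⟩)

/-- The simplicial chains of degree `j - 1` of the quotient complex, with integral coefficients.
For `j = 0` this is the copy of `ℤ` in degree `-1` that is spanned by the empty simplex. -/
abbrev QuotientChain (j : ℕ) : Type _ := FlagOrbit ρ j →₀ ℤ

/-- The boundary map from degree `j` to degree `j - 1`.  For `j = 0` it is the augmentation. -/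
noncomputable def quotientBoundary (j : ℕ) : QuotientChain ρ (j + 1) →ₗ[ℤ] QuotientChain ρ j :=
  Finsupp.linearCombination ℤ fun o : FlagOrbit ρ (j + 1) =>
    ∑ i : Fin (j + 1), Finsupp.single (FlagOrbit.face ρ i o) ((-1 : ℤ) ^ (i : ℕ))

/-- The cycles of degree `j - 1`. -/
noncomputable def quotientCycles : (j : ℕ) → Submodule ℤ (QuotientChain ρ j)
  | 0 => ⊤
  | j + 1 => LinearMap.ker (quotientBoundary ρ j)

/-- The reduced homology, in degree `j - 1`, of the quotient of the order complex of `P` by the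
group: cycles modulo boundaries. -/
abbrev QuotientReducedHomology (j : ℕ) : Type _ :=
  quotientCycles ρ j ⧸ (LinearMap.range (quotientBoundary ρ j)).submoduleOf (quotientCycles ρ j)

/-- Omitting two elements of a chain, in either order. -/
theorem FlagOrbit.face_face {j : ℕ} (o : FlagOrbit ρ (j + 2)) (a : Fin (j + 1)) (b : Fin (j + 2))
    (h : (b : ℕ) ≤ (a : ℕ)) :
    FlagOrbit.face ρ a (FlagOrbit.face ρ b o) =
      FlagOrbit.face ρ (b.castLT (lt_of_le_of_lt h a.isLt)) (FlagOrbit.face ρ a.succ o) := by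
  induction o using Quotient.inductionOn with
  | h σ =>
    refine Quotient.sound ⟨1, fun k => ?_⟩
    rw [map_one]
    change σ (b.succAbove (a.succAbove k)) = σ (a.succ.succAbove ((b.castLT _).succAbove k))
    congr 1
    ext
    simp only [Fin.succAbove, Fin.lt_def]
    split_ifs <;> simp_all <;> omega

/-- The boundary of a boundary is zero, so that all boundaries are cycles. -/
theorem quotientBoundary_comp (j : ℕ) :
    quotientBoundary ρ j ∘ₗ quotientBoundary ρ (j + 1) = 0 := by
  refine Finsupp.lhom_ext' fun o => LinearMap.ext_ring ?_
  simp only [quotientBoundary, LinearMap.comp_apply, Finsupp.lsingle_apply,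
    Finsupp.linearCombination_single, one_smul, map_sum, LinearMap.zero_apply, Finset.smul_sum,
    Finsupp.smul_single, smul_eq_mul]
  rw [← Finset.sum_product', Finset.univ_product_univ]
  let S : Finset (Fin (j + 2) × Fin (j + 1)) := {q | (q.1 : ℕ) ≤ (q.2 : ℕ)}
  rw [← Finset.sum_add_sum_compl S, ← eq_neg_iff_add_eq_zero, ← Finset.sum_neg_distrib]
  refine Finset.sum_bij (fun q hq => (q.2.succ,
    q.1.castLT (lt_of_le_of_lt (Finset.mem_filter.mp hq).2 q.2.isLt))) ?_ ?_ ?_ ?_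
  · rintro ⟨b, a⟩ hq
    simp only [S, Finset.mem_compl, Finset.mem_filter_univ, Fin.val_succ, Fin.val_castLT] at hq ⊢
    omega
  · rintro ⟨b, a⟩ hq ⟨b', a'⟩ hq' h
    simp only [Prod.mk.injEq, Fin.ext_iff, Fin.val_castLT] at h ⊢
    simp only [Fin.val_succ] at h
    omega
  · rintro ⟨b, a⟩ hq
    simp only [S, Finset.mem_compl, Finset.mem_filter_univ, not_le] at hq
    have hb : b ≠ 0 := by
      rintro rfl
      simp at hq
    refine ⟨(a.castSucc, b.pred hb), ?_, ?_⟩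
    · simp only [S, Finset.mem_filter_univ, Fin.val_castSucc, Fin.val_pred]
      omega
    · simp
  · rintro ⟨b, a⟩ hq
    simp only [S, Finset.mem_filter_univ] at hq
    rw [FlagOrbit.face_face ρ o a b hq, ← Finsupp.single_neg]
    congr 1
    simp only [Fin.val_succ, Fin.val_castLT, pow_succ]
    ring

end QuotientComplex

/-! ## The Tits building and its quotient by a principal congruence subgroup -/

/-- The proper nonzero subspaces of `V`, ordered by inclusion.  The Tits building of `V` is the
order complex of this poset: its `k`-simplices are the flags `0 ⊊ V₀ ⊊ ⋯ ⊊ V_k ⊊ V`. -/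
abbrev TitsPoset (K V : Type*) [Field K] [AddCommGroup V] [Module K V] : Type _ :=
  {W : Submodule K V // W ≠ ⊥ ∧ W ≠ ⊤}

/-- The linear automorphisms of `V` act on the poset of proper nonzero subspaces,
by taking the image of a subspace. -/
def titsAction (K V : Type*) [Field K] [AddCommGroup V] [Module K V] :
    (V ≃ₗ[K] V) →* (TitsPoset K V ≃o TitsPoset K V) where
  toFun e :=
    { toFun := fun W => ⟨W.1.map (e : V →ₗ[K] V), by
        simpa [Submodule.map_eq_top_iff] using W.2⟩
      invFun := fun W => ⟨W.1.map (e.symm : V →ₗ[K] V), by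
        simpa [Submodule.map_eq_top_iff] using W.2⟩
      left_inv := fun W => Subtype.ext <| by
        simp [← Submodule.map_comp]
      right_inv := fun W => Subtype.ext <| by
        simp [← Submodule.map_comp]
      map_rel_iff' := by
        intro W W'
        exact Submodule.map_le_map_iff_of_injective e.injective W.1 W'.1 }
  map_one' := by
    refine RelIso.ext fun W => Subtype.ext ?_
    exact Submodule.map_id W.1
  map_mul' e f := by
    refine RelIso.ext fun W => Subtype.ext ?_
    exact Submodule.map_comp (f : V →ₗ[K] V) (e : V →ₗ[K] V) W.1

/-- The principal congruence subgroup `Γ_n(p)` of level `p`: the kernel of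
`SL_n(ℤ) → SL_n(ℤ/p)`. -/
def principalCongruenceSubgroup (n p : ℕ) :
    Subgroup (Matrix.SpecialLinearGroup (Fin n) ℤ) :=
  (Matrix.SpecialLinearGroup.map (n := Fin n) (Int.castRingHom (ZMod p))).ker

/-- The action of `Γ_n(p)` on the proper nonzero subspaces of `ℚⁿ`, through
`Γ_n(p) ⊆ SL_n(ℤ) ⊆ SL_n(ℚ)`. -/
noncomputable def congruenceAction (n p : ℕ) :
    principalCongruenceSubgroup n p →*
      (TitsPoset ℚ (Fin n → ℚ) ≃o TitsPoset ℚ (Fin n → ℚ)) :=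
  (titsAction ℚ (Fin n → ℚ)).comp
    (Matrix.SpecialLinearGroup.toLin'.comp
      ((Matrix.SpecialLinearGroup.map (n := Fin n) (Int.castRingHom ℚ)).comp
        (principalCongruenceSubgroup n p).subtype))

/-- The reduced homology, in degree `n - 2`, of the quotient by `Γ_n(p)` of the Tits building of
`ℚⁿ` (for `n ≥ 1`; for `n = 1` the building is empty and the degree is `-1`). -/
abbrev TitsQuotientTopHomology (n p : ℕ) : Type :=
  QuotientReducedHomology (congruenceAction n p) (n - 1)

/-- The number `|Gr_k(𝔽_p^m)|` of `k`-dimensional subspaces of `𝔽_p^m`. -/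
noncomputable def grassmannianCard (p : ℕ) [Fact p.Prime] (k m : ℕ) : ℕ :=
  Nat.card {W : Submodule (ZMod p) (Fin m → ZMod p) // Module.finrank (ZMod p) W = k}

/-! Put `q = (p - 1) / 2`. A rational subspace `W` meets `ℤⁿ` in a direct summand, which reduces
modulo `p` to a subspace of `𝔽_pⁿ` of the same dimension. An integral basis of the summand has a
determinant class well defined up to sign, so the reduction carries a label in `𝔽_pˣ / ±1`, a set of
`q` elements; it is encoded here by nonzero squares. Two rational flags are equivalent under
`Γ_n(p)` exactly when their labelled reductions agree (`exists_rel_of_reduceFlag_eq`), and every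
labelled flag occurs (`exists_reduceFlag_eq`). The quotient complex is therefore the complex of
chains of labelled proper nonzero subspaces of `𝔽_pⁿ`, ordered by strict inclusion with labels
ignored.

Its top homology is computed by adding vertices one at a time. If a complex has homology only in its
top degree, and a new vertex is attached along a link with the same property one dimension lower,
then the ranks add (`Spherical.finrank_chainCycles`). Fix a line `L` and begin with one labelled
copy of `L` and all labelled proper subspaces strictly containing `L`: a cone, of rank `0`. Each of
the other `q - 1` copies of `L` has as link the labelled interval above `L`, and contributes
`t_{n-1}`. Next add the subspaces `X` not containing `L`, by increasing dimension `k`. The link of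
`X` is the join of everything below `X`, of rank `t_k`, with the labelled proper subspaces
containing `X + L`. The latter set is empty for `k = n - 1`; otherwise it is the join of the `q`
copies of `X + L` with the interval above them, of rank `(q - 1) t_{n-k-1}`. There are `p^k
|Gr_k(𝔽_p^{n-1})|` such `X` (`card_subspaces_avoiding`), each with `q` labels. Summing these
contributions in `spherical_labelledInterval` gives the recursion. -/

/-! ### Simplicial chains of a strict order, and homology under adding a vertex. -/

section ChainsOfRelation

set_option linter.unusedSectionVars false

variable {α : Type*} [DecidableEq α] (r : α → α → Prop) [DecidableRel r]

/-- The sign `(-1)^i` of a member `x` of a chain `s`, where `i` is its position. -/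
def posSign (x : α) (s : Finset α) : ℤ := (-1) ^ (s.filter (r · x)).card

/-- The simplicial boundary, extended to arbitrary finite sets. -/
noncomputable def chainBoundary : (Finset α →₀ ℤ) →ₗ[ℤ] (Finset α →₀ ℤ) :=
  Finsupp.linearCombination ℤ fun s => ∑ x ∈ s, Finsupp.single (s.erase x) (posSign r x s)

/-- Add the vertex `x` to a simplex. -/
noncomputable def coneMap (x : α) : (Finset α →₀ ℤ) →ₗ[ℤ] (Finset α →₀ ℤ) :=
  Finsupp.linearCombination ℤ fun s =>
    if x ∈ s then 0 else Finsupp.single (insert x s) (posSign r x s)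

/-- Remove the vertex `x` from the simplices that contain it, and forget the others. -/
noncomputable def linkMap (x : α) : (Finset α →₀ ℤ) →ₗ[ℤ] (Finset α →₀ ℤ) :=
  Finsupp.linearCombination ℤ fun s =>
    if x ∈ s then Finsupp.single (s.erase x) (posSign r x (s.erase x)) else 0

/-- The simplicial chains on the `j`-element chains contained in `A`. -/
def chainModule (A : Finset α) (j : ℕ) : Submodule ℤ (Finset α →₀ ℤ) :=
  Finsupp.supported ℤ ℤ {s | s ⊆ A ∧ IsChain r (s : Set α) ∧ s.card = j}

/-- The simplicial cycles on the `j`-element chains contained in `A`. -/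
noncomputable def chainCycles (A : Finset α) (j : ℕ) : Submodule ℤ (Finset α →₀ ℤ) :=
  chainModule r A j ⊓ LinearMap.ker (chainBoundary r)

/-- The part of `A` that is comparable with `x`, and different from `x`. -/
def relLink (A : Finset α) (x : α) : Finset α := A.filter fun y => r y x ∨ r x y

/-- `Spherical r A s t`: the order complex of `A` is built from cones and from the empty set by
adding vertices in such a way that its reduced homology is free of rank `t` and concentrated on
the simplices with `s` vertices, which are the largest possible ones. -/
inductive Spherical : Finset α → ℕ → ℕ → Prop
  | empty : Spherical ∅ 0 1
  | cone (A : Finset α) (x : α) (s : ℕ) (hx : x ∈ A) (hA : ∀ y ∈ A, y ≠ x → r y x ∨ r x y)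
      (hs : ∀ c : Finset α, c ⊆ A → IsChain r (c : Set α) → c.card ≤ s) : Spherical A s 0
  | addVertex (A : Finset α) (x : α) (s t u : ℕ) (hx : x ∉ A) (hA : Spherical A (s + 1) t)
      (hl : Spherical (relLink r A x) s u) : Spherical (insert x A) (s + 1) (t + u)

variable {r}

theorem single_mem_chainModule {A s : Finset α} {j : ℕ} (h : s ⊆ A) (hc : IsChain r (s : Set α))
    (hj : s.card = j) (a : ℤ) : Finsupp.single s a ∈ chainModule r A j :=
  Finsupp.single_mem_supported ℤ a ⟨h, hc, hj⟩

theorem chainModule_eq_span (A : Finset α) (j : ℕ) : chainModule r A j =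
    Submodule.span ℤ ((fun s => Finsupp.single s (1 : ℤ)) ''
      {s | s ⊆ A ∧ IsChain r (s : Set α) ∧ s.card = j}) :=
  Finsupp.supported_eq_span_single ℤ _

theorem chainModule_le {A : Finset α} {j : ℕ} {M : Submodule ℤ (Finset α →₀ ℤ)}
    (h : ∀ s : Finset α, s ⊆ A → IsChain r (s : Set α) → s.card = j → Finsupp.single s 1 ∈ M) :
    chainModule r A j ≤ M := by
  rw [chainModule_eq_span, Submodule.span_le]
  rintro _ ⟨s, ⟨h1, h2, h3⟩, rfl⟩
  exact h s h1 h2 h3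

theorem chainModule_mono {A B : Finset α} (h : A ⊆ B) (j : ℕ) :
    chainModule r A j ≤ chainModule r B j :=
  chainModule_le fun _ h1 h2 h3 => single_mem_chainModule (h1.trans h) h2 h3 1

theorem chainModule_eq_bot {A : Finset α} {s j : ℕ}
    (hs : ∀ c : Finset α, c ⊆ A → IsChain r (c : Set α) → c.card ≤ s) (hj : s < j) :
    chainModule r A j = ⊥ :=
  eq_bot_iff.2 <| chainModule_le fun c h1 h2 h3 => by have := hs c h1 h2; omega

theorem chainBoundary_single (s : Finset α) : chainBoundary r (Finsupp.single s 1) =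
    ∑ x ∈ s, Finsupp.single (s.erase x) (posSign r x s) := by
  simp [chainBoundary]

theorem coneMap_single {x : α} {s : Finset α} (h : x ∉ s) :
    coneMap r x (Finsupp.single s 1) = Finsupp.single (insert x s) (posSign r x s) := by
  simp [coneMap, h]

theorem coneMap_single_smul {x : α} {s : Finset α} (h : x ∉ s) (a : ℤ) :
    coneMap r x (Finsupp.single s a) = Finsupp.single (insert x s) (a * posSign r x s) := by
  simp [coneMap, h]

theorem posSign_mul_self (x : α) (s : Finset α) : posSign r x s * posSign r x s = 1 := by
  simp [posSign, ← pow_add, ← two_mul, pow_mul]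

theorem linkMap_coneMap_single {x : α} {s : Finset α} (h : x ∉ s) :
    linkMap r x (coneMap r x (Finsupp.single s 1)) = Finsupp.single s 1 := by
  simp [coneMap_single h, linkMap, Finset.erase_insert h, posSign_mul_self]

theorem linkMap_single {x : α} {s : Finset α} (h : x ∉ s) :
    linkMap r x (Finsupp.single s 1) = 0 := by
  simp [linkMap, h]

theorem chainBoundary_mem {A : Finset α} {j : ℕ} {z : Finset α →₀ ℤ}
    (hz : z ∈ chainModule r A (j + 1)) : chainBoundary r z ∈ chainModule r A j := by
  suffices chainModule r A (j + 1) ≤ (chainModule r A j).comap (chainBoundary r) from this hz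
  refine chainModule_le fun s h1 h2 h3 => ?_
  rw [Submodule.mem_comap, chainBoundary_single]
  refine Submodule.sum_mem _ fun x hx => single_mem_chainModule
    ((Finset.erase_subset _ _).trans h1) (h2.mono (by simp)) ?_ _
  rw [Finset.card_erase_of_mem hx, h3]; rfl

theorem relLink_subset (A : Finset α) (x : α) : relLink r A x ⊆ A := Finset.filter_subset _ _

theorem mem_relLink {A : Finset α} {x y : α} : y ∈ relLink r A x ↔ y ∈ A ∧ (r y x ∨ r x y) :=
  Finset.mem_filter

theorem notMem_relLink [IsStrictOrder α r] (A : Finset α) (x : α) : x ∉ relLink r A x := by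
  simp [mem_relLink, irrefl]

theorem isChain_insert_of_subset_relLink {A : Finset α} {x : α} {s : Finset α}
    (h : s ⊆ relLink r A x) (hs : IsChain r (s : Set α)) :
    IsChain r ((insert x s : Finset α) : Set α) := by
  rw [Finset.coe_insert]
  refine hs.insert fun y hy _ => ?_
  exact (mem_relLink.1 (h hy)).2.symm

theorem coneMap_mem [IsStrictOrder α r] {A : Finset α} {x : α} {j : ℕ} {w : Finset α →₀ ℤ}
    (hw : w ∈ chainModule r (relLink r A x) j) :
    coneMap r x w ∈ chainModule r (insert x A) (j + 1) := by
  suffices chainModule r (relLink r A x) j ≤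
    (chainModule r (insert x A) (j + 1)).comap (coneMap r x) from this hw
  refine chainModule_le fun s h1 h2 h3 => ?_
  have hx : x ∉ s := fun h => notMem_relLink A x (h1 h)
  rw [Submodule.mem_comap, coneMap_single hx]
  refine single_mem_chainModule (Finset.insert_subset_insert _ (h1.trans (relLink_subset A x)))
    (isChain_insert_of_subset_relLink h1 h2) ?_ _
  rw [Finset.card_insert_of_notMem hx, h3]

theorem linkMap_coneMap [IsStrictOrder α r] {A : Finset α} {x : α} {j : ℕ} {w : Finset α →₀ ℤ}
    (hx : x ∉ A) (hw : w ∈ chainModule r A j) : linkMap r x (coneMap r x w) = w := by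
  suffices chainModule r A j ≤
    LinearMap.eqLocus (linkMap r x ∘ₗ coneMap r x) LinearMap.id from this hw
  exact chainModule_le fun s h1 h2 h3 => linkMap_coneMap_single fun h => hx (h1 h)

theorem linkMap_eq_zero {A : Finset α} {x : α} {j : ℕ} {w : Finset α →₀ ℤ}
    (hx : x ∉ A) (hw : w ∈ chainModule r A j) : linkMap r x w = 0 := by
  suffices chainModule r A j ≤ LinearMap.ker (linkMap r x) from this hw
  exact chainModule_le fun s h1 h2 h3 => linkMap_single fun h => hx (h1 h)

theorem coneMap_injOn [IsStrictOrder α r] {A : Finset α} {x : α} {j : ℕ} {w : Finset α →₀ ℤ}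
    (hx : x ∉ A) (hw : w ∈ chainModule r A j) (h : coneMap r x w = 0) : w = 0 := by
  rw [← linkMap_coneMap hx hw, h, map_zero]

theorem posSign_insert_self [IsStrictOrder α r] (x : α) (s : Finset α) :
    posSign r x (insert x s) = posSign r x s := by
  simp [posSign, Finset.filter_insert, irrefl]

/-- Exactly one of `x` and `y` lies below the other, and its presence shifts the position of the
other by one; this produces the single minus sign. -/
theorem posSign_swap [IsStrictOrder α r] {x y : α} {s : Finset α} (hx : x ∉ s) (hy : y ∈ s)
    (h : r y x ∨ r x y) : posSign r y (insert x s) * posSign r x s =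
      -(posSign r y s * posSign r x (s.erase y)) := by
  have e : insert y (s.erase y) = s := Finset.insert_erase hy
  have hxs : posSign r x s = (if r y x then -1 else 1) * posSign r x (s.erase y) := by
    conv_lhs => rw [← e]
    simp only [posSign, Finset.filter_insert]
    split_ifs
    · rw [Finset.card_insert_of_notMem (by simp), pow_succ']
    · simp
  have hys : posSign r y (insert x s) = (if r x y then -1 else 1) * posSign r y s := by
    simp only [posSign, Finset.filter_insert]
    split_ifs
    · rw [Finset.card_insert_of_notMem (by simp [hx]), pow_succ']
    · simp
  rw [hxs, hys]
  rcases h with h | h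
  · rw [if_pos h, if_neg (asymm h)]; ring
  · rw [if_pos h, if_neg (asymm h)]; ring

/-- The usual cone formula: deleting the apex gives back `w`, and deleting any other vertex
anticommutes with adding the apex by `posSign_swap`. -/
theorem chainBoundary_coneMap [IsStrictOrder α r] {A : Finset α} {x : α} {j : ℕ}
    {w : Finset α →₀ ℤ} (hw : w ∈ chainModule r (relLink r A x) j) :
    chainBoundary r (coneMap r x w) = w - coneMap r x (chainBoundary r w) := by
  suffices chainModule r (relLink r A x) j ≤ LinearMap.eqLocus (chainBoundary r ∘ₗ coneMap r x)
    (LinearMap.id - coneMap r x ∘ₗ chainBoundary r) from this hw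
  refine chainModule_le fun s h1 h2 h3 => ?_
  have hx : x ∉ s := fun h => notMem_relLink A x (h1 h)
  simp only [LinearMap.mem_eqLocus, LinearMap.comp_apply, LinearMap.sub_apply, LinearMap.id_apply]
  rw [chainBoundary_single, map_sum, coneMap_single hx,
    ← mul_one (posSign r x s), ← smul_eq_mul, ← Finsupp.smul_single, map_smul,
    chainBoundary_single, Finset.sum_insert hx, posSign_insert_self, Finset.erase_insert hx,
    smul_add, Finsupp.smul_single, smul_eq_mul, posSign_mul_self, sub_eq_add_neg,
    ← Finset.sum_neg_distrib, Finset.smul_sum]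
  congr 1
  refine Finset.sum_congr rfl fun y hy => ?_
  have hxy : y ≠ x := fun h => hx (h ▸ hy)
  rw [coneMap_single_smul (by simp [hx]), Finsupp.smul_single, smul_eq_mul,
    Finset.erase_insert_of_ne hxy.symm, ← Finsupp.single_neg, mul_comm,
    posSign_swap hx hy (mem_relLink.1 (h1 hy)).2]

theorem exists_eq_add_coneMap [IsStrictOrder α r] {A : Finset α} {x : α} {j : ℕ}
    {z : Finset α →₀ ℤ} (hz : z ∈ chainModule r (insert x A) (j + 1)) :
    ∃ y ∈ chainModule r A (j + 1), ∃ w ∈ chainModule r (relLink r A x) j,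
      y + coneMap r x w = z := by
  suffices chainModule r (insert x A) (j + 1) ≤ chainModule r A (j + 1) ⊔
      (chainModule r (relLink r A x) j).map (coneMap r x) by
    obtain ⟨y, hy, _, ⟨w, hw, rfl⟩, h⟩ := Submodule.mem_sup.1 (this hz)
    exact ⟨y, hy, w, hw, h⟩
  refine chainModule_le fun s h1 h2 h3 => ?_
  by_cases hs : x ∈ s
  · refine Submodule.mem_sup_right ⟨Finsupp.single (s.erase x) (posSign r x (s.erase x)), ?_, ?_⟩
    · refine single_mem_chainModule (fun y hy => ?_) (h2.mono (by simp)) ?_ _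
      · obtain ⟨hyx, hy⟩ := Finset.mem_erase.1 hy
        exact mem_relLink.2 ⟨Finset.mem_of_mem_insert_of_ne (h1 hy) hyx, h2 hy hs hyx⟩
      · rw [Finset.card_erase_of_mem hs, h3]; rfl
    · rw [coneMap_single_smul (by simp), posSign_mul_self, Finset.insert_erase hs]
  · exact Submodule.mem_sup_left (single_mem_chainModule
      ((Finset.subset_insert_iff_of_notMem hs).1 h1) h2 h3 1)

/-- The only simplex in this degree is the empty one, which does not see the vertex set. -/
theorem chainModule_zero_le (A B : Finset α) : chainModule r A 0 ≤ chainModule r B 0 :=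
  chainModule_le fun s _ h2 h3 => single_mem_chainModule
    (by simp [Finset.card_eq_zero.1 h3]) h2 h3 1

/-- The two components of the boundary of a cycle, away from a vertex and at it. -/
theorem cycle_components [IsStrictOrder α r] {A : Finset α} {x : α} (hx : x ∉ A) {j : ℕ}
    {y w : Finset α →₀ ℤ} (hy : y ∈ chainModule r A (j + 1))
    (hw : w ∈ chainModule r (relLink r A x) j)
    (h : chainBoundary r (y + coneMap r x w) = 0) :
    chainBoundary r w = 0 ∧ chainBoundary r y + w = 0 := by
  rw [map_add, chainBoundary_coneMap hw] at h
  have h0 : chainBoundary r w = 0 := by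
    -- In the lowest degree `w` is a multiple of the empty simplex, whose boundary is an empty sum.
    -- In higher degrees `linkMap` isolates the simplices through `x`, where only the cone on the
    -- boundary of `w` survives.
    rcases j with _ | j
    · have : chainModule r (relLink r A x) 0 ≤ LinearMap.ker (chainBoundary r) :=
        chainModule_le fun s _ _ h3 => by
          simp [Finset.card_eq_zero.1 h3, chainBoundary_single]
      exact this hw
    · have hw' := chainBoundary_mem hw
      refine coneMap_injOn (notMem_relLink A x) hw' ?_
      have hx' := notMem_relLink (r := r) A x
      have := congrArg (linkMap r x) h
      rw [map_add, map_sub, linkMap_eq_zero hx (chainBoundary_mem hy),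
        linkMap_eq_zero hx' hw, linkMap_coneMap hx' hw', map_zero] at this
      rw [show chainBoundary r w = 0 by simpa using this, map_zero]
  refine ⟨h0, ?_⟩
  rwa [h0, map_zero, sub_zero] at h

theorem Spherical.card_le [IsStrictOrder α r] {A : Finset α} {s t : ℕ} (h : Spherical r A s t)
    {c : Finset α} (hc : c ⊆ A) (hr : IsChain r (c : Set α)) : c.card ≤ s := by
  induction h generalizing c with
  | empty => simp [Finset.subset_empty.1 hc]
  | cone A x s hx hA hs => exact hs c hc hr
  | addVertex A x s t u hx _ _ ih1 ih2 =>
    by_cases hxc : x ∈ c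
    · have := ih2 (c := c.erase x) (fun y hy => ?_) (hr.mono (by simp))
      · rw [Finset.card_erase_of_mem hxc] at this; omega
      · obtain ⟨hyx, hy⟩ := Finset.mem_erase.1 hy
        exact mem_relLink.2 ⟨Finset.mem_of_mem_insert_of_ne (hc hy) hyx, hr hy hxc hyx⟩
    · exact ih1 ((Finset.subset_insert_iff_of_notMem hxc).1 hc) hr

/-- A cone has no homology. -/
theorem exists_boundary_of_cone [IsStrictOrder α r] {A : Finset α} {x : α} (hx : x ∈ A)
    (hA : ∀ y ∈ A, y ≠ x → r y x ∨ r x y) {j : ℕ} {z : Finset α →₀ ℤ}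
    (hz : z ∈ chainCycles r A j) : ∃ y ∈ chainModule r A (j + 1), chainBoundary r y = z := by
  have hx' : x ∉ A.erase x := Finset.notMem_erase _ _
  have e : insert x (A.erase x) = A := Finset.insert_erase hx
  have hl : relLink r (A.erase x) x = A.erase x :=
    Finset.filter_true_of_mem fun y hy => hA y (Finset.mem_of_mem_erase hy)
      (Finset.ne_of_mem_erase hy)
  obtain ⟨hz, h0⟩ := hz
  rcases j with _ | j
  · have hz' : z ∈ chainModule r (relLink r (A.erase x) x) 0 := chainModule_zero_le _ _ hz
    refine ⟨coneMap r x z, e ▸ coneMap_mem hz', ?_⟩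
    rw [chainBoundary_coneMap hz', h0, map_zero, sub_zero]
  · rw [← e] at hz
    obtain ⟨y, hy, w, hw, rfl⟩ := exists_eq_add_coneMap hz
    obtain ⟨h1, h2⟩ := cycle_components hx' hy hw h0
    have hy' := hy
    rw [← hl] at hy'
    refine ⟨coneMap r x y, e ▸ coneMap_mem hy', ?_⟩
    rw [chainBoundary_coneMap hy', eq_neg_of_add_eq_zero_left h2, map_neg, sub_neg_eq_add]

/-- Vanishing below the top degree. Write a cycle as `y` plus the cone on `w`. Then `w` is a cycle
of the link, so it bounds some `v` there; `y + v` is a cycle away from `x`, so it bounds some `u`;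
and `u` minus the cone on `v` bounds the original cycle. -/
theorem Spherical.exists_boundary [IsStrictOrder α r] {A : Finset α} {s t : ℕ}
    (h : Spherical r A s t) {j : ℕ} (hj : j < s) {z : Finset α →₀ ℤ}
    (hz : z ∈ chainCycles r A j) : ∃ y ∈ chainModule r A (j + 1), chainBoundary r y = z := by
  induction h generalizing j z with
  | empty => omega
  | cone A x s hx hA hs => exact exists_boundary_of_cone hx hA hz
  | addVertex A x s t u hx _ _ ih1 ih2 =>
    obtain ⟨hz, h0⟩ := hz
    rcases j with _ | j
    · obtain ⟨y, hy, h⟩ := ih1 hj ⟨chainModule_zero_le _ _ hz, h0⟩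
      exact ⟨y, chainModule_mono (Finset.subset_insert _ _) _ hy, h⟩
    · obtain ⟨y, hy, w, hw, rfl⟩ := exists_eq_add_coneMap hz
      obtain ⟨h1, h2⟩ := cycle_components hx hy hw h0
      obtain ⟨v, hv, rfl⟩ := ih2 (by omega) ⟨hw, h1⟩
      have hvA := chainModule_mono (relLink_subset A x) _ hv
      obtain ⟨u, hu, hu'⟩ := ih1 hj (z := y + v)
        ⟨add_mem hy hvA, LinearMap.mem_ker.2 (by rw [map_add, h2])⟩
      refine ⟨u - coneMap r x v, sub_mem
        (chainModule_mono (Finset.subset_insert _ _) _ hu) (coneMap_mem hv), ?_⟩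
      rw [map_sub, hu', chainBoundary_coneMap hv]
      abel

/-- Rank–nullity for the map sending a top cycle of `insert x A` to its link at `x`. The kernel
consists of the top cycles of `A`. The map reaches every top cycle of the link, because such a cycle
has degree below the top one of `A`, hence bounds in `A`, and the cone on it can be closed up. -/
theorem Spherical.finrank_chainCycles [Finite α] [IsStrictOrder α r] {A : Finset α} {s t : ℕ}
    (h : Spherical r A s t) : Module.finrank ℤ (chainCycles r A s) = t := by
  induction h with
  | empty =>
    have e : chainCycles r ∅ 0 = Finsupp.supported ℤ ℤ {(∅ : Finset α)} := by
      have e' : chainModule r ∅ 0 = Finsupp.supported ℤ ℤ {(∅ : Finset α)} := by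
        unfold chainModule
        congr 1
        ext s
        simp only [Set.mem_ofPred_eq, Set.mem_singleton_iff, Finset.card_eq_zero]
        exact ⟨fun h => h.2.2, fun h => by simp [h]⟩
      rw [chainCycles, inf_eq_left.2, e']
      refine chainModule_le fun s _ _ h3 => ?_
      simp [Finset.card_eq_zero.1 h3, chainBoundary_single]
    rw [e, (Finsupp.supportedEquivFinsupp (M := ℤ) (R := ℤ) {(∅ : Finset α)}).finrank_eq,
      Module.finrank_finsupp_self]
    simp
  | cone A x s hx hA hs =>
    have : chainCycles r A s = ⊥ := eq_bot_iff.2 fun z hz => by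
      -- A top cycle of a cone bounds a chain one degree higher, where there are no simplices.
      obtain ⟨y, hy, rfl⟩ := exists_boundary_of_cone hx hA hz
      rw [chainModule_eq_bot hs (Nat.lt_succ_self s)] at hy
      simp [(Submodule.mem_bot ℤ).1 hy]
    rw [this, finrank_bot]
  | addVertex A x s t u hx hA hl ih1 ih2 =>
    let f : chainCycles r (insert x A) (s + 1) →ₗ[ℤ] (Finset α →₀ ℤ) :=
      linkMap r x ∘ₗ (chainCycles r (insert x A) (s + 1)).subtype
    have hx' := notMem_relLink (r := r) A x
    have hr : LinearMap.range f = chainCycles r (relLink r A x) s := by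
      ext w
      constructor
      · rintro ⟨⟨z, hz, h0⟩, rfl⟩
        obtain ⟨y, hy, w, hw, rfl⟩ := exists_eq_add_coneMap hz
        have : f ⟨y + coneMap r x w, hz, h0⟩ = w := by
          change linkMap r x (y + coneMap r x w) = w
          rw [map_add, linkMap_eq_zero hx hy, linkMap_coneMap hx' hw, zero_add]
        rw [this]
        exact ⟨hw, (cycle_components hx hy hw h0).1⟩
      · rintro ⟨hw, h0⟩
        obtain ⟨y, hy, h1⟩ := hA.exists_boundary (Nat.lt_succ_self s)
          (z := w) ⟨chainModule_mono (relLink_subset A x) _ hw, h0⟩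
        refine ⟨⟨coneMap r x w - y, sub_mem (coneMap_mem hw)
          (chainModule_mono (Finset.subset_insert _ _) _ hy), LinearMap.mem_ker.2 ?_⟩, ?_⟩
        · rw [map_sub, h1, chainBoundary_coneMap hw, h0, map_zero, sub_zero,
            sub_self]
        · change linkMap r x (coneMap r x w - y) = w
          rw [map_sub, linkMap_eq_zero hx hy, linkMap_coneMap hx' hw, sub_zero]
    have hk : (LinearMap.ker f).map (chainCycles r (insert x A) (s + 1)).subtype =
        chainCycles r A (s + 1) := by
      ext z
      constructor
      · rintro ⟨⟨z, hz, h0⟩, hf, rfl⟩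
        obtain ⟨y, hy, w, hw, rfl⟩ := exists_eq_add_coneMap hz
        have : linkMap r x (y + coneMap r x w) = 0 := hf
        rw [map_add, linkMap_eq_zero hx hy, linkMap_coneMap hx' hw, zero_add] at this
        subst this
        simp only [map_zero, add_zero] at h0 ⊢
        exact ⟨hy, h0⟩
      · rintro ⟨hz, h0⟩
        exact ⟨⟨z, chainModule_mono (Finset.subset_insert _ _) _ hz, h0⟩,
          linkMap_eq_zero hx hz, rfl⟩
    have h := Submodule.finrank_quotient_add_finrank (LinearMap.ker f)
    have e := ((LinearMap.ker f).equivMapOfInjective _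
      (Submodule.injective_subtype (chainCycles r (insert x A) (s + 1)))).finrank_eq
    rw [hk, ih1] at e
    rw [f.quotKerEquivRange.finrank_eq, hr, ih2, e] at h
    omega

end ChainsOfRelation

/-! ### Joins, and adding a whole family of vertices. -/

section Join

set_option linter.unusedSectionVars false

variable {α : Type*} [DecidableEq α] {r : α → α → Prop} [DecidableRel r]

/-- Induction on the construction of `A`: a cone remains a cone after joining with `B`, and a vertex
with link `Λ` in `A` has link `Λ ∪ B` in `A ∪ B`, so the ranks are multiplied by `t'` at each stage.
-/
theorem Spherical.join [IsStrictOrder α r] {A B : Finset α} {s t s' t' : ℕ}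
    (hA : Spherical r A s t) (hB : Spherical r B s' t') (h : ∀ a ∈ A, ∀ b ∈ B, r a b) :
    Spherical r (A ∪ B) (s + s') (t * t') := by
  induction hA with
  | empty => simpa using hB
  | cone A x s hx hA hs =>
    rw [zero_mul]
    refine .cone _ x _ (Finset.mem_union_left _ hx) (fun y hy hyx => ?_) fun c hc hr => ?_
    · rcases Finset.mem_union.1 hy with hy | hy
      · exact hA y hy hyx
      · exact .inr (h x hx y hy)
    · have h1 := hs (c.filter (· ∈ A)) (fun y hy => (Finset.mem_filter.1 hy).2)
        (hr.mono (Finset.coe_subset.2 (Finset.filter_subset _ _)))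
      have h2 := hB.card_le (c := c.filter (· ∉ A)) (fun y hy => by
        obtain ⟨h1, h2⟩ := Finset.mem_filter.1 hy
        exact (Finset.mem_union.1 (hc h1)).resolve_left h2)
        (hr.mono (Finset.coe_subset.2 (Finset.filter_subset _ _)))
      have := Finset.card_filter_add_card_filter_not (s := c) (· ∈ A)
      omega
  | addVertex A x s t u hx _ _ ih1 ih2 =>
    have hxB : x ∉ B := fun hB => irrefl (r := r) x (h x (Finset.mem_insert_self _ _) x hB)
    have e : relLink r (A ∪ B) x = relLink r A x ∪ B := by
      ext y
      simp only [mem_relLink, Finset.mem_union]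
      have := h x (Finset.mem_insert_self _ _) y
      tauto
    have h1 := ih1 fun a ha => h a (Finset.mem_insert_of_mem ha)
    have h2 := ih2 fun a ha => h a (Finset.mem_insert_of_mem (relLink_subset A x ha))
    rw [Nat.add_right_comm] at h1 ⊢
    rw [Finset.insert_union, add_mul]
    exact .addVertex _ x _ _ _ (by simp [hx, hxB]) h1 (e ▸ h2)

/-- Add the elements of `B` in the order of their values under `f`. -/
theorem Spherical.union [IsStrictOrder α r] {A B : Finset α} {s t : ℕ} (f u : α → ℕ)
    (hA : Spherical r A (s + 1) t) (hd : Disjoint A B)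
    (hf : ∀ x ∈ B, ∀ y ∈ B, r x y → f x < f y)
    (hl : ∀ x ∈ B, Spherical r (relLink r A x ∪ B.filter (r · x)) s (u x)) :
    Spherical r (A ∪ B) (s + 1) (t + ∑ x ∈ B, u x) := by
  induction B using Finset.induction_on_max_value f with
  | empty => simpa using hA
  | insert x B hx hmax ih =>
    rw [Finset.disjoint_insert_right] at hd
    -- The vertex added last has maximal value under `f`, so nothing in `B` lies above it: its link
    -- meets `B` only from below, and it does not enter the sets prescribed for the earlier
    -- vertices.
    have hB : ∀ y ∈ B, ¬ r x y := fun y hy h => absurd (hmax y hy)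
      (not_le.2 (hf x (Finset.mem_insert_self _ _) y (Finset.mem_insert_of_mem hy) h))
    have ih := ih hd.2 (fun a ha b hb => hf a (Finset.mem_insert_of_mem ha) b
      (Finset.mem_insert_of_mem hb)) fun y hy => by
        have := hl y (Finset.mem_insert_of_mem hy)
        rwa [Finset.filter_insert, if_neg (hB y hy)] at this
    rw [Finset.sum_insert hx, Finset.union_insert, add_left_comm, add_comm (u x)]
    refine .addVertex _ x _ _ _ (by simp [hx, hd.1]) ih ?_
    have := hl x (Finset.mem_insert_self _ _)
    rw [Finset.filter_insert, if_neg (irrefl (r := r) x)] at this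
    convert this using 1
    ext y
    simp only [mem_relLink, Finset.mem_union, Finset.mem_filter]
    have := hB y
    tauto

/-- A nonempty set of pairwise incomparable elements. -/
theorem Spherical.antichain [IsStrictOrder α r] {A : Finset α} (hA : A.Nonempty)
    (h : ∀ a ∈ A, ∀ b ∈ A, ¬ r a b) : Spherical r A 1 (A.card - 1) := by
  induction hA using Finset.Nonempty.cons_induction with
  | singleton a =>
    refine .cone _ a _ (by simp) (by simp) fun c hc _ => ?_
    simpa using Finset.card_le_card hc
  | cons a s ha hs ih =>
    have e : relLink r s a = ∅ := Finset.filter_false_of_mem fun y hy => by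
      simp [h y (by simp [hy]) a (by simp), h a (by simp) y (by simp [hy])]
    -- The first point is a cone, of rank `0`; every further point has empty link and adds `1`.
    rw [Finset.card_cons, Finset.cons_eq_insert,
      show s.card + 1 - 1 = s.card - 1 + 1 from (Nat.sub_add_cancel hs.card_pos).symm]
    exact .addVertex _ a 0 _ 1 ha (ih fun x hx y hy => h x (by simp [hx]) y (by simp [hy]))
      (e ▸ .empty)

end Join

/-! ### Counting the subspaces that avoid a given line. -/

section CountingSubspaces

open Module

theorem finrank_map_add_finrank_ker_inf {K V V' : Type*} [Field K] [AddCommGroup V] [Module K V]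
    [FiniteDimensional K V] [AddCommGroup V'] [Module K V'] (f : V →ₗ[K] V') (X : Submodule K V) :
    finrank K (X.map f) + finrank K (X ⊓ LinearMap.ker f : Submodule K V) = finrank K X := by
  have h := LinearMap.finrank_range_add_finrank_ker (f.domRestrict X)
  rwa [LinearMap.range_domRestrict, LinearMap.ker_domRestrict, ← Submodule.finrank_map_subtype_eq,
    Submodule.map_comap_subtype] at h

theorem finrank_comap_subtype {K V : Type*} [Field K] [AddCommGroup V] [Module K V]
    {X Y : Submodule K V} (h : X ≤ Y) :
    finrank K (X.comap Y.subtype) = finrank K X := by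
  rw [← Submodule.finrank_map_subtype_eq, Submodule.map_comap_subtype, inf_eq_right.2 h]

variable {K V : Type*} [Field K] [AddCommGroup V] [Module K V] [FiniteDimensional K V]

/-- The subspaces between `L` and `W` correspond to the subspaces of the quotient. -/
theorem card_subspaces_between {L W : Submodule K V} (hLW : L ≤ W) {m : ℕ}
    (hm : finrank K W = finrank K L + m) (k : ℕ) :
    Nat.card {Y : Submodule K V // L ≤ Y ∧ Y ≤ W ∧ finrank K Y = finrank K L + k} =
      Nat.card {X : Submodule K (Fin m → K) // finrank K X = k} := by
  have hL' := finrank_comap_subtype hLW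
  have hq := Submodule.finrank_quotient_add_finrank (L.comap W.subtype)
  let e : (W ⧸ L.comap W.subtype) ≃ₗ[K] (Fin m → K) :=
    LinearEquiv.ofFinrankEq _ _ (by rw [finrank_fin_fun]; omega)
  let f : W →ₗ[K] (Fin m → K) := e.toLinearMap ∘ₗ (L.comap W.subtype).mkQ
  have hf : Function.Surjective f := e.surjective.comp (Submodule.mkQ_surjective _)
  have hker : LinearMap.ker f = L.comap W.subtype := by
    rw [LinearEquiv.ker_comp, Submodule.ker_mkQ]
  have hfin : ∀ Y : Submodule K V, L ≤ Y → Y ≤ W →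
      finrank K ((Y.comap W.subtype).map f) + finrank K L = finrank K Y := fun Y h1 h2 => by
    rw [← finrank_comap_subtype h2, ← finrank_map_add_finrank_ker_inf f, hker,
      inf_eq_right.2 (Submodule.comap_mono h1), hL']
  have hle : ∀ X : Submodule K (Fin m → K), L ≤ (X.comap f).map W.subtype := fun X => by
    rw [← inf_eq_right.2 hLW, ← Submodule.map_comap_subtype, ← hker]
    exact Submodule.map_mono (LinearMap.ker_le_comap _)
  have hle' : ∀ X : Submodule K (Fin m → K), (X.comap f).map W.subtype ≤ W := fun X =>
    Submodule.map_subtype_le _ _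
  have hinv : ∀ X : Submodule K (Fin m → K),
      (((X.comap f).map W.subtype).comap W.subtype).map f = X := fun X => by
    rw [Submodule.comap_map_eq_of_injective (Submodule.injective_subtype W),
      Submodule.map_comap_eq_of_surjective hf]
  refine Nat.card_congr
    { toFun := fun Y => ⟨(Y.1.comap W.subtype).map f, by
        have := hfin Y.1 Y.2.1 Y.2.2.1
        have := Y.2.2.2
        omega⟩
      invFun := fun X => ⟨(X.1.comap f).map W.subtype, hle _, hle' _, by
        have := hfin _ (hle X.1) (hle' X.1)
        rw [hinv, X.2] at this
        omega⟩
      left_inv := fun Y => Subtype.ext ?_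
      right_inv := fun X => Subtype.ext (hinv X) }
  change (((Y.1.comap W.subtype).map f).comap f).map W.subtype = Y.1
  rw [Submodule.comap_map_eq, hker, sup_eq_left.2 (Submodule.comap_mono Y.2.1),
    Submodule.map_comap_subtype, inf_eq_right.2 Y.2.2.1]

/-- These functionals form a torsor under the annihilator of `L`, since `U` and `y` together span
`L`. -/
theorem card_dual_apply_eq_one {U L : Submodule K V} (hUL : U ≤ L)
    (hL : finrank K L = finrank K U + 1) {y : V} (hy : y ∈ L) (hyU : y ∉ U) :
    Nat.card {φ : Dual K V // U ≤ LinearMap.ker φ ∧ φ y = 1} =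
      Nat.card K ^ (finrank K V - finrank K L) := by
  have hUy : U ⊔ Submodule.span K {y} = L := by
    refine Submodule.eq_of_le_of_finrank_le (sup_le hUL (by simpa using hy)) ?_
    have := Submodule.finrank_lt_finrank_of_lt (show U < U ⊔ Submodule.span K {y} from
      lt_of_le_of_ne le_sup_left fun h => hyU (h ▸ Submodule.mem_sup_right
        (Submodule.mem_span_singleton_self y)))
    omega
  obtain ⟨ψ, h1, h2⟩ := Submodule.exists_le_ker_of_notMem hyU
  have hann : ∀ φ : Dual K V, φ ∈ L.dualAnnihilator ↔ U ≤ LinearMap.ker φ ∧ φ y = 0 := fun φ => by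
    rw [← hUy, Submodule.mem_dualAnnihilator]
    change U ⊔ Submodule.span K {y} ≤ LinearMap.ker φ ↔ _
    rw [sup_le_iff, Submodule.span_singleton_le_iff_mem, LinearMap.mem_ker]
  have hψ : U ≤ LinearMap.ker ((ψ y)⁻¹ • ψ) := h2.trans fun x hx => by
    simp [LinearMap.mem_ker.1 hx]
  have : Nat.card {φ : Dual K V // U ≤ LinearMap.ker φ ∧ φ y = 1} =
      Nat.card L.dualAnnihilator := by
    refine Nat.card_congr (Equiv.subtypeEquiv (Equiv.subRight ((ψ y)⁻¹ • ψ)) fun φ => ?_)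
    rw [hann, Equiv.subRight_apply]
    refine and_congr ⟨fun h x hx => ?_, fun h x hx => ?_⟩ ?_
    · rw [LinearMap.mem_ker, LinearMap.sub_apply, LinearMap.mem_ker.1 (h hx),
        LinearMap.mem_ker.1 (hψ hx), sub_zero]
    · have := LinearMap.mem_ker.1 (h hx)
      rwa [LinearMap.sub_apply, LinearMap.mem_ker.1 (hψ hx), sub_zero] at this
    · simp [h1, sub_eq_zero]
  rw [this, natCard_eq_pow_finrank (K := K)]
  congr 1
  have := Subspace.finrank_add_finrank_dualAnnihilator_eq L
  omega

/-- The hyperplanes that contain `U` but not `L`. -/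
theorem card_hyperplanes_avoiding {U L : Submodule K V} (hUL : U ≤ L)
    (hL : finrank K L = finrank K U + 1) :
    Nat.card {X : Submodule K V // U ≤ X ∧ ¬ L ≤ X ∧ finrank K X + 1 = finrank K V} =
      Nat.card K ^ (finrank K V - finrank K L) := by
  obtain ⟨y, hy, hyU⟩ : ∃ y ∈ L, y ∉ U := Set.not_subset.1 fun h => by
    have : L = U := le_antisymm h hUL
    rw [this] at hL
    omega
  have hLX : ∀ X : Submodule K V, U ≤ X → y ∈ X → L ≤ X := fun X h1 h2 => by
    have : U < X ⊓ L := lt_of_le_of_ne (le_inf h1 hUL) fun h => hyU (h ▸ ⟨h2, hy⟩)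
    have := Submodule.finrank_lt_finrank_of_lt this
    exact inf_eq_right.1 (Submodule.eq_of_le_of_finrank_le inf_le_right (by omega))
  rw [← card_dual_apply_eq_one hUL hL hy hyU]
  symm
  refine Nat.card_congr (Equiv.ofBijective (fun φ => ⟨LinearMap.ker φ.1, φ.2.1, fun h => ?_, ?_⟩)
    ⟨fun φ ψ h => ?_, fun X => ?_⟩)
  · have := φ.2.2
    rw [LinearMap.mem_ker.1 (h hy)] at this
    exact zero_ne_one this
  · refine Dual.finrank_ker_add_one_of_ne_zero fun h => ?_
    have := φ.2.2
    rw [h, LinearMap.zero_apply] at this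
    exact zero_ne_one this
  · refine Subtype.ext (LinearMap.ext fun x => ?_)
    -- The normalisation `φ y = 1` lets the kernel determine the functional: its value at `x` is the
    -- multiple of `y` that moves `x` into the kernel.
    have hx : x - φ.1 x • y ∈ LinearMap.ker φ.1 := by
      simp [LinearMap.mem_ker, φ.2.2]
    rw [show LinearMap.ker φ.1 = LinearMap.ker ψ.1 from congrArg Subtype.val h,
      LinearMap.mem_ker, map_sub, map_smul, ψ.2.2, smul_eq_mul, mul_one, sub_eq_zero] at hx
    exact hx.symm
  · obtain ⟨X, h1, h2, h3⟩ := X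
    obtain ⟨ψ, h4, h5⟩ := Submodule.exists_le_ker_of_notMem fun h => h2 (hLX X h1 h)
    have h6 : X ≤ LinearMap.ker ((ψ y)⁻¹ • ψ) := h5.trans fun x hx => by
      simp [LinearMap.mem_ker.1 hx]
    have h7 : ((ψ y)⁻¹ • ψ) y = 1 := by simp [h4]
    refine ⟨⟨(ψ y)⁻¹ • ψ, h1.trans h6, h7⟩, Subtype.ext ?_⟩
    refine (Submodule.eq_of_le_of_finrank_le h6 ?_).symm
    have := Dual.finrank_ker_add_one_of_ne_zero (f := (ψ y)⁻¹ • ψ) fun h => by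
      rw [h] at h7; exact zero_ne_one h7
    omega

theorem card_hyperplanes_of_subspace_avoiding {U L Y : Submodule K V} (hUL : U ≤ L) (hLY : L ≤ Y)
    (hL : finrank K L = finrank K U + 1) {k : ℕ} (hY : finrank K Y = finrank K L + k) :
    Nat.card {X : Submodule K V // U ≤ X ∧ X ≤ Y ∧ ¬ L ≤ X ∧ finrank K X = finrank K U + k} =
      Nat.card K ^ k := by
  have h := card_hyperplanes_avoiding (K := K) (V := Y) (U := U.comap Y.subtype)
    (L := L.comap Y.subtype) (Submodule.comap_mono hUL)
    (by rw [finrank_comap_subtype hLY, finrank_comap_subtype (hUL.trans hLY), hL])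
  rw [finrank_comap_subtype hLY, hY, Nat.add_sub_cancel_left] at h
  rw [← h]
  have hiff : ∀ (Z : Submodule K V) (X : Submodule K Y), Z ≤ Y →
      (Z ≤ X.map Y.subtype ↔ Z.comap Y.subtype ≤ X) := fun Z X hZ => by
    rw [← Submodule.map_le_map_iff_of_injective (Submodule.injective_subtype Y),
      Submodule.map_comap_subtype, inf_eq_right.2 hZ]
  refine (Nat.card_congr (Equiv.ofBijective (fun X => ⟨X.1.map Y.subtype,
    (hiff U _ (hUL.trans hLY)).2 X.2.1, Submodule.map_subtype_le _ _,
    fun h => X.2.2.1 ((hiff L _ hLY).1 h), by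
      have := X.2.2.2
      rw [Submodule.finrank_map_subtype_eq]
      omega⟩) ⟨fun X X' h => ?_, fun X => ?_⟩)).symm
  · exact Subtype.ext (Submodule.map_injective_of_injective (Submodule.injective_subtype Y)
      (congrArg Subtype.val h))
  · obtain ⟨X, h1, h2, h3, h4⟩ := X
    have h5 : (X.comap Y.subtype).map Y.subtype = X := by
      rw [Submodule.map_comap_subtype, inf_eq_right.2 h2]
    refine ⟨⟨X.comap Y.subtype, Submodule.comap_mono h1, fun h => h3 ?_, ?_⟩, Subtype.ext h5⟩
    · rwa [← hiff L _ hLY, h5] at h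
    · rw [finrank_comap_subtype h2]
      omega

theorem finrank_sup_line {U L X : Submodule K V} (hUL : U ≤ L)
    (hL : finrank K L = finrank K U + 1) (hUX : U ≤ X) (hLX : ¬ L ≤ X) :
    finrank K (X ⊔ L : Submodule K V) = finrank K X + 1 := by
  have h1 := Submodule.finrank_sup_add_finrank_inf_eq X L
  have h2 : X ⊓ L < L := lt_of_le_of_ne inf_le_right fun h => hLX (inf_eq_right.1 h)
  have h3 := Submodule.finrank_lt_finrank_of_lt h2
  have h4 := Submodule.finrank_mono (le_inf hUX hUL)
  omega

/-- Fibre the set over `Y = X ⊔ L`. The base consists of the `k`-dimensional subspaces of `W / L`;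
the fibre over `Y` consists of the hyperplanes of `Y` that contain `U` but not `L`. -/
theorem card_subspaces_avoiding [Finite V] {U L W : Submodule K V} (hUL : U ≤ L) (hLW : L ≤ W)
    (hL : finrank K L = finrank K U + 1) {m : ℕ} (hW : finrank K W = finrank K L + m) (k : ℕ) :
    Nat.card {X : Submodule K V // U ≤ X ∧ X ≤ W ∧ ¬ L ≤ X ∧ finrank K X = finrank K U + k} =
      Nat.card K ^ k * Nat.card {X : Submodule K (Fin m → K) // finrank K X = k} := by
  let B := {Y : Submodule K V // L ≤ Y ∧ Y ≤ W ∧ finrank K Y = finrank K L + k}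
  have := Fintype.ofFinite B
  let e : {X : Submodule K V // U ≤ X ∧ X ≤ W ∧ ¬ L ≤ X ∧ finrank K X = finrank K U + k} ≃
      Σ Y : B, {X : Submodule K V // U ≤ X ∧ X ≤ Y.1 ∧ ¬ L ≤ X ∧ finrank K X = finrank K U + k} :=
    { toFun := fun X => ⟨⟨X.1 ⊔ L, le_sup_right, sup_le X.2.2.1 hLW, by
          rw [finrank_sup_line hUL hL X.2.1 X.2.2.2.1, X.2.2.2.2]; omega⟩,
        ⟨X.1, X.2.1, le_sup_left, X.2.2.2⟩⟩
      invFun := fun p => ⟨p.2.1, p.2.2.1, p.2.2.2.1.trans p.1.2.2.1, p.2.2.2.2⟩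
      left_inv := fun _ => rfl
      right_inv := by
        rintro ⟨⟨Y, h1, h2, h3⟩, ⟨X, h4, h5, h6, h7⟩⟩
        have : X ⊔ L = Y := Submodule.eq_of_le_of_finrank_le (sup_le h5 h1) (by
          rw [finrank_sup_line hUL hL h4 h6]; omega)
        subst this
        rfl }
  rw [Nat.card_congr e, Nat.card_sigma, Finset.sum_congr rfl fun Y _ =>
    card_hyperplanes_of_subspace_avoiding hUL Y.2.1 hL Y.2.2.2, Finset.sum_const, smul_eq_mul,
    Finset.card_univ, ← Nat.card_eq_fintype_card, mul_comm, card_subspaces_between hLW hW]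

end CountingSubspaces

/-! ### The recursion for the complex of labelled subspaces. -/

section LabelledSubspaces

open Module
open scoped Classical

/-- The rank of the homology of the labelled proper subspaces of a space of dimension `m + 1`, for
`q` labels, where `N k m` is the number of `k`-dimensional subspaces of an `(m + 1)`-dimensional
space that do not contain a given line. -/
def labelledRank (q : ℕ) (N : ℕ → ℕ → ℕ) : ℕ → ℕ
  | 0 => 1
  | m + 1 => (q - 1) * labelledRank q N m +
      (∑ k : Fin m, N (k + 1) (m + 1) *
        (q * (labelledRank q N k * ((q - 1) * labelledRank q N (m - 1 - k)))) +
      N (m + 1) (m + 1) * (q * labelledRank q N m))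
  termination_by m => m
  decreasing_by all_goals omega

variable {K V β : Type*} [Field K] [AddCommGroup V] [Module K V]

variable (K V β) in
/-- Strict inclusion of labelled subspaces; the labels are ignored. -/
def labelledLT (a b : Submodule K V × β) : Prop := a.1 < b.1

instance : IsStrictOrder (Submodule K V × β) (labelledLT K V β) where
  irrefl a := lt_irrefl a.1
  trans _ _ _ h h' := lt_trans (α := Submodule K V) h h'

variable [Finite V]

/-- The subspaces strictly between `U` and `W`, with labels in `S`. -/
noncomputable def labelledInterval (S : Finset β) (U W : Submodule K V) :
    Finset (Submodule K V × β) :=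
  (Set.toFinite {Y : Submodule K V | U < Y ∧ Y < W}).toFinset ×ˢ S

theorem mem_labelledInterval {S : Finset β} {U W : Submodule K V} {a : Submodule K V × β} :
    a ∈ labelledInterval S U W ↔ (U < a.1 ∧ a.1 < W) ∧ a.2 ∈ S := by
  simp [labelledInterval]

/-- The subspaces between `U` and `W`, and different from `W`, with labels in `S`. -/
noncomputable def labelledIco (S : Finset β) (U W : Submodule K V) :
    Finset (Submodule K V × β) :=
  (Set.toFinite {Y : Submodule K V | U ≤ Y ∧ Y < W}).toFinset ×ˢ S

theorem mem_labelledIco {S : Finset β} {U W : Submodule K V} {a : Submodule K V × β} :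
    a ∈ labelledIco S U W ↔ (U ≤ a.1 ∧ a.1 < W) ∧ a.2 ∈ S := by
  simp [labelledIco]

theorem labelledIco_eq_union {S : Finset β} {U W : Submodule K V} (h : U < W) :
    labelledIco S U W = ({U} : Finset (Submodule K V)) ×ˢ S ∪ labelledInterval S U W := by
  ext ⟨Y, l⟩
  simp only [mem_labelledIco, mem_labelledInterval, Finset.mem_union, Finset.mem_product,
    Finset.mem_singleton]
  constructor
  · rintro ⟨⟨h1, h2⟩, h3⟩
    rcases h1.eq_or_lt with h1 | h1
    · exact .inl ⟨h1.symm, h3⟩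
    · exact .inr ⟨⟨h1, h2⟩, h3⟩
  · rintro (⟨rfl, h3⟩ | ⟨⟨h1, h2⟩, h3⟩)
    · exact ⟨⟨le_rfl, h⟩, h3⟩
    · exact ⟨⟨h1.le, h2⟩, h3⟩

/-- Dimensions are distinct along a chain and lie strictly between those of `U` and `W`. -/
theorem card_chain_le {S : Finset β} {U W : Submodule K V} {m : ℕ}
    (hm : finrank K W = finrank K U + m + 1) {c : Finset (Submodule K V × β)}
    (hc : c ⊆ labelledInterval S U W) (hr : IsChain (labelledLT K V β) (c : Set _)) :
    c.card ≤ m := by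
  have h1 : Set.InjOn (fun a : Submodule K V × β => finrank K a.1) c := fun a ha b hb h => by
    by_contra hab
    rcases hr ha hb hab with h' | h'
    · exact (Submodule.finrank_lt_finrank_of_lt h').ne h
    · exact (Submodule.finrank_lt_finrank_of_lt h').ne' h
  have h2 : c.image (fun a => finrank K a.1) ⊆ Finset.Ioo (finrank K U) (finrank K W) := by
    intro x hx
    obtain ⟨a, ha, rfl⟩ := Finset.mem_image.1 hx
    obtain ⟨⟨h1, h2⟩, -⟩ := mem_labelledInterval.1 (hc ha)
    exact Finset.mem_Ioo.2
      ⟨Submodule.finrank_lt_finrank_of_lt h1, Submodule.finrank_lt_finrank_of_lt h2⟩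
  have h3 := Finset.card_le_card h2
  rw [Finset.card_image_of_injOn h1, Nat.card_Ioo] at h3
  omega

/-- One copy `(L, l)` of `L` is the apex of a cone over the open interval above `L`. Copies of `L`
are mutually incomparable, so each of the remaining ones has that open interval as its link and
contributes `s`. -/
theorem spherical_upper {S : Finset β} {l : β} (hl : l ∈ S) {U L W : Submodule K V} {m s : ℕ}
    (hUL : U < L) (hLW : L < W) (hm : finrank K W = finrank K U + m + 2)
    (h : Spherical (labelledLT K V β) (labelledInterval S L W) m s) :
    Spherical (labelledLT K V β) (labelledIco S L W)
      (m + 1) ((S.card - 1) * s) := by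
  have h0 : Spherical (labelledLT K V β) (insert (L, l) (labelledInterval S L W)) (m + 1) 0 := by
    refine .cone _ (L, l) _ (Finset.mem_insert_self _ _) (fun y hy hyx => ?_) fun c hc hr => ?_
    · exact .inr (mem_labelledInterval.1 (Finset.mem_of_mem_insert_of_ne hy hyx)).1.1
    · refine card_chain_le (S := S) (m := m + 1) (U := U) (W := W) (by omega)
        (fun a ha => mem_labelledInterval.2 ?_) hr
      rcases Finset.mem_insert.1 (hc ha) with rfl | ha
      · exact ⟨⟨hUL, hLW⟩, hl⟩
      · obtain ⟨⟨h1, h2⟩, h3⟩ := mem_labelledInterval.1 ha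
        exact ⟨⟨hUL.trans h1, h2⟩, h3⟩
  have h1 := h0.union (B := ({L} : Finset (Submodule K V)) ×ˢ S.erase l) (fun a => finrank K a.1) (fun _ => s) ?_ ?_ ?_
  · rw [Finset.sum_const, Finset.card_product, Finset.card_singleton, one_mul, smul_eq_mul,
      Finset.card_erase_of_mem hl, zero_add] at h1
    convert h1 using 1
    rw [labelledIco_eq_union hLW, Finset.insert_eq, Finset.union_right_comm]
    congr 1
    rw [← Finset.singleton_product_singleton, ← Finset.product_union, ← Finset.insert_eq,
      Finset.insert_erase hl]
  · rw [Finset.disjoint_left]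
    rintro ⟨Y, l'⟩ h1 h2
    simp only [Finset.mem_insert, mem_labelledInterval, Prod.mk.injEq, Finset.mem_product,
      Finset.mem_singleton, Finset.mem_erase] at h1 h2
    rcases h1 with h1 | h1
    · exact h2.2.1 h1.2
    · exact h1.1.1.ne' h2.1
  · exact fun x _ y _ h => Submodule.finrank_lt_finrank_of_lt h
  · rintro ⟨Y, l'⟩ hx
    obtain rfl : Y = L := Finset.mem_singleton.1 (Finset.mem_product.1 hx).1
    convert h using 1
    ext ⟨Z, l''⟩
    simp only [Finset.mem_union, mem_relLink, Finset.mem_insert, mem_labelledInterval,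
      Prod.mk.injEq, Finset.mem_filter, Finset.mem_product, Finset.mem_singleton]
    constructor
    · rintro (⟨⟨rfl, _⟩ | h, h'⟩ | ⟨⟨rfl, _⟩, h'⟩)
      · exact absurd h' (by simp [labelledLT])
      · exact h
      · exact absurd h' (by simp [labelledLT])
    · exact fun h => .inl ⟨.inr h, .inr h.1.1⟩

/-- A subspace containing `L` cannot lie inside `X`, so comparability with `X` can only mean
containing both `X` and `L`. -/
theorem relLink_upper {S : Finset β} {L W X : Submodule K V} {l : β} (hX : ¬ L ≤ X) :
    relLink (labelledLT K V β)
      (labelledIco S L W) (X, l) =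
    labelledIco S (X ⊔ L) W := by
  ext ⟨Y, l'⟩
  simp only [mem_relLink, mem_labelledIco,
    labelledLT, sup_le_iff]
  constructor
  · rintro ⟨⟨⟨h1, h2⟩, h3⟩, h | h⟩
    · exact absurd (h1.trans h.le) hX
    · exact ⟨⟨⟨h.le, h1⟩, h2⟩, h3⟩
  · rintro ⟨⟨⟨h1, h2⟩, h3⟩, h4⟩
    exact ⟨⟨⟨h2, h3⟩, h4⟩, .inr (lt_of_le_of_ne h1 fun h => hX (h ▸ h2))⟩

/-- Intervals between arbitrary `U` and `W` are treated, rather than only the whole building,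
because the induction applies to the intervals below `X` and above `L` and `X ⊔ L`. -/
theorem spherical_labelledInterval [Finite K] {S : Finset β} (hS : S.Nonempty) (m : ℕ)
    {U W : Submodule K V} (hUW : U ≤ W) (hm : finrank K W = finrank K U + m + 1) :
    Spherical (labelledLT K V β) (labelledInterval S U W) m
      (labelledRank S.card (fun k m => Nat.card K ^ k *
        Nat.card {X : Submodule K (Fin m → K) // finrank K X = k}) m) := by
  set N : ℕ → ℕ → ℕ := fun k m => Nat.card K ^ k *
        Nat.card {X : Submodule K (Fin m → K) // finrank K X = k} with hN
  induction m using Nat.strong_induction_on generalizing U W with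
  | _ m ih =>
  rcases m with _ | m
  · have : labelledInterval S U W = ∅ := Finset.eq_empty_of_forall_notMem fun a ha => by
      obtain ⟨⟨h1, h2⟩, -⟩ := mem_labelledInterval.1 ha
      have := Submodule.finrank_lt_finrank_of_lt h1
      have := Submodule.finrank_lt_finrank_of_lt h2
      omega
    rw [this, labelledRank]
    exact .empty
  obtain ⟨l, hl⟩ := hS
  obtain ⟨y, hyW, hyU⟩ : ∃ y ∈ W, y ∉ U := Set.not_subset.1 fun h => by
    have : W = U := le_antisymm h hUW
    rw [this] at hm
    omega
  obtain ⟨L, hUL, hLW, hL⟩ : ∃ L : Submodule K V, U ≤ L ∧ L ≤ W ∧ finrank K L = finrank K U + 1 :=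
    ⟨U ⊔ Submodule.span K {y}, le_sup_left, sup_le hUW (by simpa using hyW),
      Submodule.finrank_sup_span_singleton hyU⟩
  have hUL' : U < L := lt_of_le_of_ne hUL fun h => by rw [← h] at hL; omega
  have hLW' : L < W := lt_of_le_of_ne hLW fun h => by rw [← h] at hm; omega
  have h1 := spherical_upper hl hUL' hLW' (by omega) (ih m (by omega) hLW (by omega))
  -- The rank of the link of a subspace `X` of dimension `k + 1` over `U`. At `k = m` it is a
  -- hyperplane with `X ⊔ L = W`, so the upper half of the link is empty and contributes the factor
  -- `1`.
  let g : ℕ → ℕ := fun k => if k = m then labelledRank S.card N m else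
    labelledRank S.card N k * ((S.card - 1) * labelledRank S.card N (m - 1 - k))
  let B := (Set.toFinite {X : Submodule K V | U < X ∧ X < W ∧ ¬ L ≤ X}).toFinset
  have hB : ∀ X : Submodule K V, X ∈ B ↔ U < X ∧ X < W ∧ ¬ L ≤ X := by simp [B]
  have h2 := h1.union (B := B ×ˢ S) (fun a => finrank K a.1)
    (fun a => g (finrank K a.1 - finrank K U - 1)) ?_ ?_ ?_
  · convert h2 using 1
    · ext ⟨X, l'⟩
      simp only [mem_labelledInterval, Finset.mem_union, Finset.mem_product, hB,
        mem_labelledIco]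
      have := fun h : L ≤ X => hUL'.trans_le h
      tauto
    · rw [labelledRank, Finset.sum_product]
      congr 1
      have hsum : ∀ X ∈ B, ∑ y ∈ S, g (finrank K (X, y).1 - finrank K U - 1) =
          S.card * g (finrank K X - finrank K U - 1) := fun X _ => by
        change ∑ _y ∈ S, g (finrank K X - finrank K U - 1) = _
        rw [Finset.sum_const, smul_eq_mul]
      rw [Finset.sum_congr rfl hsum]
      have hmaps : ∀ X ∈ B, finrank K X - finrank K U - 1 ∈ Finset.range (m + 1) := by
        intro X hX
        obtain ⟨h1, h2, h3⟩ := (hB X).1 hX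
        have := Submodule.finrank_lt_finrank_of_lt h2
        rw [Finset.mem_range]
        omega
      rw [← Finset.sum_fiberwise_of_maps_to hmaps]
      have hfib : ∀ k ∈ Finset.range (m + 1),
          ∑ X ∈ B.filter (fun X : Submodule K V => finrank K X - finrank K U - 1 = k),
            S.card * g (finrank K X - finrank K U - 1) =
          N (k + 1) (m + 1) * (S.card * g k) := by
        intro k hk
        rw [Finset.mem_range] at hk
        rw [Finset.sum_congr rfl fun X hX => by rw [(Finset.mem_filter.1 hX).2],
          Finset.sum_const, smul_eq_mul]
        congr 1
        rw [hN]
        dsimp only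
        rw [← card_subspaces_avoiding hUL hLW hL (m := m + 1) (by omega) (k + 1)]
        rw [← Fintype.card_coe, ← Nat.card_eq_fintype_card]
        refine Nat.card_congr (Equiv.subtypeEquivRight fun X => ?_)
        rw [Finset.mem_filter, hB]
        constructor
        · rintro ⟨⟨h1, h2, h3⟩, h4⟩
          have := Submodule.finrank_lt_finrank_of_lt h1
          exact ⟨h1.le, h2.le, h3, by omega⟩
        · rintro ⟨h1, h2, h3, h4⟩
          exact ⟨⟨lt_of_le_of_ne h1 fun h => by rw [h] at h4; omega,
            lt_of_le_of_ne h2 fun h => h3 (h ▸ hLW), h3⟩, by omega⟩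
      rw [Finset.sum_congr rfl hfib, Finset.sum_range_succ, Finset.sum_range]
      congr 1
      · refine Finset.sum_congr rfl fun k _ => ?_
        simp only [g]
        rw [if_neg k.2.ne]
      · simp [g]
  · rw [Finset.disjoint_left]
    rintro ⟨Y, l'⟩ h1 h2
    simp only [Finset.mem_product, mem_labelledIco, hB] at h1 h2
    exact h2.1.2.2 h1.1.1
  · exact fun x _ y _ h => Submodule.finrank_lt_finrank_of_lt h
  · rintro ⟨X, l'⟩ hX
    obtain ⟨⟨hUX, hXW, hLX⟩, -⟩ : (U < X ∧ X < W ∧ ¬ L ≤ X) ∧ l' ∈ S := by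
      simpa [hB] using hX
    have hXL := finrank_sup_line hUL hL hUX.le hLX
    have hf1 := Submodule.finrank_lt_finrank_of_lt hUX
    have hf2 := Submodule.finrank_lt_finrank_of_lt hXW
    obtain ⟨k, hk⟩ : ∃ k, finrank K X = finrank K U + k + 1 :=
      ⟨finrank K X - finrank K U - 1, by omega⟩
    -- Subspaces of `X` cannot contain `L`, so every labelled subspace strictly between `U` and `X`
    -- belongs to the family being added.
    have hfil : (B ×ˢ S).filter (labelledLT K V β · (X, l')) = labelledInterval S U X := by
      ext ⟨Y, l''⟩
      rw [Finset.mem_filter]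
      simp only [Finset.mem_product, hB, mem_labelledInterval, labelledLT]
      have h1 := fun h : Y < X => h.trans hXW
      have h2 := fun (h : Y < X) (h' : L ≤ Y) => hLX (h'.trans h.le)
      tauto
    rw [relLink_upper hLX, hfil]
    dsimp only
    rw [show finrank K X - finrank K U - 1 = k by omega]
    have hX1 := ih k (by omega) hUX.le hk
    by_cases hkm : k = m
    · have hXLW : X ⊔ L = W := Submodule.eq_of_le_of_finrank_le (sup_le hXW.le hLW) (by omega)
      have he : labelledIco S (X ⊔ L) W = ∅ := by
        rw [hXLW]
        ext ⟨Y, l''⟩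
        simp only [mem_labelledIco]
        simp only [Finset.notMem_empty, iff_false]
        exact fun h => absurd h.1.2 (not_lt_of_ge h.1.1)
      rw [he, Finset.empty_union]
      subst hkm
      simpa [g] using hX1
    · have hXLW : X ⊔ L < W := lt_of_le_of_ne (sup_le hXW.le hLW) fun h => by
        rw [h] at hXL; omega
      have hX2 := ih (m - 1 - k) (by omega) hXLW.le (by omega)
      have hX3 : Spherical (labelledLT K V β)
          (({X ⊔ L} : Finset (Submodule K V)) ×ˢ S) 1 (S.card - 1) := by
        have := Spherical.antichain (r := labelledLT K V β) (A := ({X ⊔ L} : Finset (Submodule K V)) ×ˢ S)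
          ⟨(X ⊔ L, l), by simp [hl]⟩ (by
            rintro ⟨a, la⟩ ha ⟨b, lb⟩ hb h
            simp only [Finset.mem_product, Finset.mem_singleton] at ha hb
            rw [labelledLT, ha.1, hb.1] at h
            exact lt_irrefl _ h)
        rwa [Finset.card_product, Finset.card_singleton, one_mul] at this
      have hX4 := hX1.join (hX3.join hX2 ?_) ?_
      · simp only [g, if_neg hkm]
        convert hX4 using 1
        · rw [labelledIco_eq_union hXLW, Finset.union_comm]
        · omega
      · rintro ⟨a, la⟩ ha ⟨b, lb⟩ hb
        simp only [Finset.mem_product, Finset.mem_singleton, mem_labelledInterval] at ha hb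
        rw [labelledLT, ha.1]
        exact hb.1.1
      · rintro ⟨a, la⟩ ha ⟨b, lb⟩ hb
        simp only [Finset.mem_union, Finset.mem_product, Finset.mem_singleton,
          mem_labelledInterval] at ha hb
        refine ha.1.2.trans_le (le_sup_left.trans ?_ (b := X ⊔ L))
        rcases hb with hb | hb
        · exact hb.1.ge
        · exact hb.1.1.le

end LabelledSubspaces

/-! ### Lifting matrices of determinant `±1` from `ℤ/p` to `ℤ`. -/

section LiftingMatrices

open Matrix

variable {ι : Type*} [Fintype ι] [DecidableEq ι]

theorem specialLinearGroup_ext {R : Type*} [CommRing R] {A B : Matrix.SpecialLinearGroup ι R}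
    (h : (A : Matrix ι ι R) = B) : A = B := Subtype.ext h

theorem diag2n_eq_transvections {F : Type*} [Field F] {i j : ι} (hij : i ≠ j) (a : F)
    (ha : a ≠ 0) : Matrix.SpecialLinearGroup.diag2n hij a ha =
      Matrix.SpecialLinearGroup.transvection hij (a - 1) * Matrix.SpecialLinearGroup.transvection hij.symm 1 *
      Matrix.SpecialLinearGroup.transvection hij (a⁻¹ - 1) *
      Matrix.SpecialLinearGroup.transvection hij.symm (-a) := by
  refine specialLinearGroup_ext ?_
  simp only [Matrix.SpecialLinearGroup.coe_mul, Matrix.SpecialLinearGroup.diag2n_coe,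
    Matrix.SpecialLinearGroup.transvection_coe, mul_add, add_mul, one_mul, mul_one,
    single_mul_single_same, single_mul_single_of_ne _ _ _ _ hij,
    single_mul_single_of_ne _ _ _ _ hij.symm, add_zero]
  ext k l
  simp only [diagonal_apply, Matrix.add_apply, one_apply, single_apply]
  have := hij.symm
  split_ifs <;> grind

variable {p : ℕ} [Fact p.Prime]

theorem transvection_mem_range_map {i j : ι} (hij : i ≠ j) (b : ZMod p) :
    Matrix.SpecialLinearGroup.transvection hij b ∈
      (Matrix.SpecialLinearGroup.map (n := ι) (Int.castRingHom (ZMod p))).range := by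
  obtain ⟨c, rfl⟩ := ZMod.intCast_surjective b
  refine ⟨Matrix.SpecialLinearGroup.transvection hij c, Subtype.ext ?_⟩
  change (Matrix.transvection i j c).map (Int.castRingHom (ZMod p)) = Matrix.transvection i j _
  rw [transvection, Matrix.map_add _ (map_add _), Matrix.map_one _ (map_zero _) (map_one _),
    Matrix.map_single, transvection, eq_intCast]

theorem diagonal_mem_range_map (D : ι → ZMod p) (A : Matrix.SpecialLinearGroup ι (ZMod p))
    (hA : (A : Matrix ι ι (ZMod p)) = diagonal D) :
    A ∈
      (Matrix.SpecialLinearGroup.map (n := ι) (Int.castRingHom (ZMod p))).range := by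
  induction hn : (Finset.univ.filter fun i => D i ≠ 1).card using Nat.strong_induction_on
    generalizing D A with
  | _ n ih =>
  have h : (diagonal D).det = 1 := by rw [← hA, Matrix.SpecialLinearGroup.det_coe]
  by_cases hD : ∀ i, D i = 1
  · have e : A = 1 := by
      refine specialLinearGroup_ext ?_
      rw [hA, Matrix.SpecialLinearGroup.coe_one, ← diagonal_one]
      exact congrArg diagonal (funext hD)
    rw [e]
    exact one_mem _
  push Not at hD
  obtain ⟨i, hi⟩ := hD
  have hprod : ∏ k, D k = 1 := by rwa [det_diagonal] at h
  have hi0 : D i ≠ 0 := fun h0 => by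
    rw [Finset.prod_eq_zero (Finset.mem_univ i) h0] at hprod
    exact zero_ne_one hprod
  -- The entries have product `1`, so a single one cannot differ from `1`. Moving the factor `D i`
  -- into position `j` lowers the number of nontrivial entries, at the cost of a product of
  -- transvections.
  obtain ⟨j, hij, hj⟩ : ∃ j, i ≠ j ∧ D j ≠ 1 := by
    by_contra! hc
    rw [Finset.prod_eq_single i (fun j _ hj => hc j hj.symm) (by simp)] at hprod
    exact hi hprod
  let D' : ι → ZMod p := fun k => if k = i then 1 else if k = j then D i * D j else D k
  have hmul : diagonal D = (Matrix.SpecialLinearGroup.diag2n hij (D i) hi0 : Matrix ι ι (ZMod p)) *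
      diagonal D' := by
    rw [Matrix.SpecialLinearGroup.diag2n_coe, diagonal_mul_diagonal]
    congr 1
    funext k
    simp only [D']
    split_ifs with h1 h2
    · rw [h1, mul_one]
    · rw [h2, inv_mul_cancel_left₀ hi0]
    · rw [one_mul]
  have h' : (diagonal D').det = 1 := by
    have := congrArg Matrix.det hmul
    rw [h, Matrix.det_mul, Matrix.SpecialLinearGroup.det_coe, one_mul] at this
    exact this.symm
  have hcard : (Finset.univ.filter fun i => D' i ≠ 1).card < n := by
    rw [← hn]
    refine Finset.card_lt_card (Finset.ssubset_iff_of_subset (fun k hk => ?_) |>.2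
      ⟨i, by simpa using hi, by simp [D']⟩)
    simp only [Finset.mem_filter_univ, D'] at hk ⊢
    split_ifs at hk with h1 h2
    · exact absurd rfl hk
    · rwa [h2]
    · exact hk
  let A' : Matrix.SpecialLinearGroup ι (ZMod p) := ⟨diagonal D', h'⟩
  have e : A = Matrix.SpecialLinearGroup.diag2n hij (D i) hi0 * A' :=
    specialLinearGroup_ext (hA.trans hmul)
  rw [e, diag2n_eq_transvections]
  exact mul_mem (mul_mem (mul_mem (mul_mem (transvection_mem_range_map _ _)
    (transvection_mem_range_map _ _)) (transvection_mem_range_map _ _))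
    (transvection_mem_range_map _ _)) (ih _ hcard D' A' rfl rfl)

/-- Gaussian elimination writes a matrix as transvections around a diagonal matrix, which is itself
a product of transvections; each transvection lifts by lifting its entry. -/
theorem map_intCast_zmod_surjective :
    Function.Surjective (Matrix.SpecialLinearGroup.map (n := ι) (Int.castRingHom (ZMod p))) := by
  intro A
  obtain ⟨l, l', D, h⟩ := Pivot.exists_list_transvec_mul_diagonal_mul_list_transvec
    (A : Matrix ι ι (ZMod p))
  have hD : (diagonal D).det = 1 := by
    have hM := Matrix.SpecialLinearGroup.det_coe A
    rw [h] at hM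
    simpa [det_mul] using hM
  let B : Matrix.SpecialLinearGroup ι (ZMod p) := ⟨diagonal D, hD⟩
  have hcoe : ∀ L : List (TransvectionStruct ι (ZMod p)),
      (((L.map TransvectionStruct.toSpecialLinearGroup).prod : Matrix.SpecialLinearGroup ι (ZMod p)) :
        Matrix ι ι (ZMod p)) = (L.map TransvectionStruct.toMatrix).prod := fun L => by
    induction L with
    | nil => rfl
    | cons t L ih =>
      rw [List.map_cons, List.prod_cons, Matrix.SpecialLinearGroup.coe_mul, ih]
      simp
  have hmem : ∀ L : List (TransvectionStruct ι (ZMod p)),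
      (L.map TransvectionStruct.toSpecialLinearGroup).prod ∈
        (Matrix.SpecialLinearGroup.map (n := ι) (Int.castRingHom (ZMod p))).range := fun L =>
    Subgroup.list_prod_mem _ fun x hx => by
      obtain ⟨t, -, rfl⟩ := List.mem_map.1 hx
      exact transvection_mem_range_map _ _
  have e : A =
      (l.map TransvectionStruct.toSpecialLinearGroup).prod * B *
        (l'.map TransvectionStruct.toSpecialLinearGroup).prod := by
    refine specialLinearGroup_ext ?_
    simp only [Matrix.SpecialLinearGroup.coe_mul, hcoe]
    exact h
  refine MonoidHom.mem_range.1 ?_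
  rw [e]
  exact mul_mem (mul_mem (hmem l) (diagonal_mem_range_map D B rfl)) (hmem l')

theorem exists_lift_of_det_sq_eq_one (M : Matrix ι ι (ZMod p)) (hM : M.det ^ 2 = 1) :
    ∃ N : Matrix ι ι ℤ, N.map (Int.castRingHom (ZMod p)) = M ∧ IsUnit N.det := by
  have key : ∀ M : Matrix ι ι (ZMod p), M.det = 1 →
      ∃ N : Matrix ι ι ℤ, N.map (Int.castRingHom (ZMod p)) = M ∧ IsUnit N.det := fun M hM => by
    obtain ⟨N, hN⟩ := map_intCast_zmod_surjective (ι := ι) ⟨M, hM⟩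
    exact ⟨N, congrArg Subtype.val hN, by simp⟩
  rcases mul_self_eq_one_iff.1 ((sq _).symm.trans hM) with h | h
  · exact key M h
  rcases isEmpty_or_nonempty ι with hι | ⟨⟨i⟩⟩
  · exact key M (det_isEmpty)
  -- A sign change in one coordinate reduces determinant `-1` to determinant `1`, over `ℤ` and over
  -- `ℤ/p` compatibly.
  let D : ∀ R : Type, [CommRing R] → Matrix ι ι R := fun R _ =>
    diagonal (fun k => if k = i then -1 else 1)
  have hD : ∀ (R : Type) [CommRing R], (D R).det = -1 := fun R _ => by
    simp [D, Finset.prod_ite_eq']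
  obtain ⟨N, h1, h2⟩ := key (D (ZMod p) * M) (by rw [det_mul, hD, h]; ring)
  refine ⟨D ℤ * N, ?_, by rw [det_mul, hD]; simpa using h2⟩
  have hDm : (D ℤ).map (Int.castRingHom (ZMod p)) = D (ZMod p) := by
    simp only [D]
    rw [diagonal_map (map_zero _)]
    congr 1
    funext k
    simp [apply_ite (Int.castRingHom (ZMod p))]
  have hDD : D (ZMod p) * D (ZMod p) = 1 := by
    simp only [D]
    rw [diagonal_mul_diagonal, ← diagonal_one]
    congr 1
    funext k
    split_ifs <;> simp
  rw [Matrix.map_mul, hDm, h1, ← mul_assoc, hDD, one_mul]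

theorem exists_blockTriangular_lift (b : ι → ℕ) (M : Matrix ι ι (ZMod p))
    (hM : M.BlockTriangular b) (h : ∀ a, (M.toSquareBlock b a).det ^ 2 = 1) :
    ∃ N : Matrix ι ι ℤ, N.map (Int.castRingHom (ZMod p)) = M ∧ N.BlockTriangular b ∧
      IsUnit N.det := by
  choose N hN hdet using fun a => exists_lift_of_det_sq_eq_one _ (h a)
  choose f hf using ZMod.intCast_surjective (n := p)
  -- Only the diagonal blocks affect the determinant, so the entries above them are lifted
  -- arbitrarily.
  let L : Matrix ι ι ℤ := fun i j =>
    if h : b i = b j then N (b j) ⟨i, h⟩ ⟨j, rfl⟩ else if b i < b j then f (M i j) else 0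
  have hL : L.BlockTriangular b := fun i j hij => by
    simp only [L]
    rw [dif_neg hij.ne', if_neg hij.not_gt]
  have hblock : ∀ a, L.toSquareBlock b a = N a := fun a => by
    ext ⟨i, hi⟩ ⟨j, rfl⟩
    exact dif_pos hi
  refine ⟨L, ?_, hL, ?_⟩
  · ext i j
    rw [map_apply]
    simp only [L]
    split_ifs with h1 h2
    · exact congrFun (congrFun (hN (b j)) ⟨i, h1⟩) ⟨j, rfl⟩
    · exact hf _
    · rw [map_zero, hM (lt_of_le_of_ne (not_lt.1 h2) (Ne.symm h1))]
  · rw [hL.det]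
    refine (IsUnit.prod_iff).2 fun a _ => ?_
    rw [hblock]
    exact hdet a

end LiftingMatrices

/-! ### Stabilizers of standard flags and the determinants of their upper left blocks. -/

section TopBlock

open Matrix

variable {n : ℕ} {R : Type*} [CommRing R]

/-- `M` maps the span of the first `d` basis vectors to itself. -/
def LowerLeftZero (d : ℕ) (M : Matrix (Fin n) (Fin n) R) : Prop :=
  ∀ i j : Fin n, (j : ℕ) < d → d ≤ (i : ℕ) → M i j = 0

/-- The determinant of the upper left block of size `d`. -/
def topDet (d : ℕ) (M : Matrix (Fin n) (Fin n) R) : R :=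
  (M.toSquareBlockProp fun i => (i : ℕ) < d).det

theorem LowerLeftZero.mul {d : ℕ} {A B : Matrix (Fin n) (Fin n) R} (hA : LowerLeftZero d A)
    (hB : LowerLeftZero d B) : LowerLeftZero d (A * B) := fun i j hj hi => by
  rw [mul_apply]
  refine Finset.sum_eq_zero fun k _ => ?_
  rcases lt_or_ge (k : ℕ) d with h | h
  · rw [hA i k h hi, zero_mul]
  · rw [hB k j hj h, mul_zero]

theorem LowerLeftZero.map {S : Type*} [CommRing S] (f : R →+* S) {d : ℕ}
    {A : Matrix (Fin n) (Fin n) R} (hA : LowerLeftZero d A) : LowerLeftZero d (A.map f) :=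
  fun i j hj hi => by rw [map_apply, hA i j hj hi, map_zero]

theorem topDet_mul {d : ℕ} (A : Matrix (Fin n) (Fin n) R) {B : Matrix (Fin n) (Fin n) R}
    (hB : LowerLeftZero d B) : topDet d (A * B) = topDet d A * topDet d B := by
  unfold topDet
  rw [← det_mul]
  congr 1
  have h := toBlock_mul_eq_add (fun i : Fin n => (i : ℕ) < d) (fun i : Fin n => (i : ℕ) < d)
    (fun i : Fin n => (i : ℕ) < d) A B
  have h0 : B.toBlock (fun i : Fin n => ¬ (i : ℕ) < d) (fun i : Fin n => (i : ℕ) < d) = 0 := by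
    ext i j
    exact hB _ _ j.2 (not_lt.1 i.2)
  rw [h0, Matrix.mul_zero, add_zero] at h
  exact h

theorem topDet_map {S : Type*} [CommRing S] (f : R →+* S) (d : ℕ)
    (A : Matrix (Fin n) (Fin n) R) : topDet d (A.map f) = f (topDet d A) := by
  unfold topDet
  rw [RingHom.map_det]
  rfl

theorem det_eq_topDet_mul {d : ℕ} {A : Matrix (Fin n) (Fin n) R} (hA : LowerLeftZero d A) :
    A.det = topDet d A * (A.toSquareBlockProp fun i => ¬ (i : ℕ) < d).det :=
  twoBlockTriangular_det A _ fun i hi j hj => hA i j hj (not_lt.1 hi)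

theorem topDet_diagonal (d : ℕ) (t : Fin n → R) :
    topDet d (diagonal t) = ∏ i : {i : Fin n // (i : ℕ) < d}, t i := by
  unfold topDet
  rw [← det_diagonal]
  congr 1
  ext i j
  simp [toSquareBlockProp, diagonal_apply, Subtype.ext_iff]

/-- The block determinant divides a unit of `ℤ`. This is why orientations are recorded only up to
sign. -/
theorem topDet_sq_of_isUnit {d : ℕ} {A : Matrix (Fin n) (Fin n) ℤ} (hA : LowerLeftZero d A)
    (h : IsUnit A.det) : topDet d A ^ 2 = 1 := by
  rw [det_eq_topDet_mul hA] at h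
  exact Int.sq_eq_one_of_sq_le_three (by
    rcases Int.isUnit_iff.1 (isUnit_of_mul_isUnit_left h) with h | h <;> rw [h] <;> norm_num)
    (isUnit_of_mul_isUnit_left h).ne_zero

/-- The square of the determinant of the upper left block is the product of the squares of the
determinants of the diagonal blocks that it contains. -/
theorem topDet_eq_prod (b : Fin n → ℕ) {d : ℕ} (hd : ∀ i : Fin n, (i : ℕ) < d ↔ b i ≤ d)
    {A : Matrix (Fin n) (Fin n) R} (hA : A.BlockTriangular b) :
    topDet d A = ∏ a ∈ Finset.univ.image b,
      if a ≤ d then (A.toSquareBlock b a).det else 1 := by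
  -- Replacing everything outside the upper left block by the identity keeps block triangularity and
  -- makes the full determinant equal to `topDet d A`.
  let T : Matrix (Fin n) (Fin n) R := of fun i j =>
    if (i : ℕ) < d then (if (j : ℕ) < d then A i j else 0) else if i = j then 1 else 0
  have h1 : T.det = topDet d A := by
    rw [det_eq_topDet_mul (d := d) (A := T) fun i j hj hi => by
      have : i ≠ j := fun h => by rw [h] at hi; omega
      simp [T, hi.not_gt, this]]
    have h2 : T.toSquareBlockProp (fun i => ¬ (i : ℕ) < d) = 1 := by
      ext i j
      have := i.2
      simp [toSquareBlockProp, T, one_apply, Subtype.ext_iff, not_lt.1 i.2]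
    have h3 : topDet d T = topDet d A := by
      unfold topDet
      congr 1
      ext i j
      simp [toSquareBlockProp, T, i.2, j.2]
    rw [h2, det_one, mul_one, h3]
  have hT : T.BlockTriangular b := fun i j hij => by
    have h := hA hij
    have : i ≠ j := fun h => by rw [h] at hij; exact lt_irrefl _ hij
    simp [T, h, this]
  rw [← h1, hT.det]
  refine Finset.prod_congr rfl fun a _ => ?_
  split_ifs with ha
  · congr 1
    ext ⟨i, hi⟩ ⟨j, hj⟩
    simp [toSquareBlock, toSquareBlockProp, T, (hd i).2 (hi.trans_le ha), (hd j).2 (hj.trans_le ha)]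
  · have : T.toSquareBlock b a = 1 := by
      ext ⟨i, hi⟩ ⟨j, hj⟩
      have : ¬ (i : ℕ) < d := fun h => ha (hi ▸ (hd i).1 h)
      simp [toSquareBlock, toSquareBlockProp, T, this, one_apply]
    rw [this, det_one]

/-- A matrix that stabilizes a standard flag, up to signs also as a flag of oriented subspaces,
lifts to an integral matrix with the same property. -/
theorem exists_lift_lowerLeftZero {p : ℕ} [Fact p.Prime] (hp : 3 ≤ p) (D : Set ℕ)
    {M : Matrix (Fin n) (Fin n) (ZMod p)} (hM : ∀ d ∈ D, LowerLeftZero d M)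
    (hdet : ∀ d ∈ D, topDet d M ^ 2 = 1) (h1 : M.det = 1) :
    ∃ N : Matrix.SpecialLinearGroup (Fin n) ℤ,
      (N : Matrix (Fin n) (Fin n) ℤ).map (Int.castRingHom (ZMod p)) = M ∧
      ∀ d ∈ D, LowerLeftZero d (N : Matrix (Fin n) (Fin n) ℤ) := by
  classical
  have hex : ∀ i : Fin n, ∃ d, (d ∈ D ∨ d = n) ∧ (i : ℕ) < d := fun i => ⟨n, .inr rfl, i.2⟩
  -- The least dimension in the flag, with `n` adjoined, that exceeds `i`: the blocks of `b` are the
  -- graded pieces of the flag.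
  let b : Fin n → ℕ := fun i => Nat.find (hex i)
  have hb : ∀ i, (b i ∈ D ∨ b i = n) ∧ (i : ℕ) < b i := fun i => Nat.find_spec (hex i)
  have hbd : ∀ d, (d ∈ D ∨ d = n) → ∀ i : Fin n, (i : ℕ) < d ↔ b i ≤ d := fun d hd i =>
    ⟨fun h => Nat.find_min' (hex i) ⟨hd, h⟩, fun h => (hb i).2.trans_le h⟩
  have hn : LowerLeftZero n M := fun i _ _ hi => absurd i.2 (not_lt.2 hi)
  have hM' : ∀ d, (d ∈ D ∨ d = n) → LowerLeftZero d M := by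
    rintro d (hd | rfl)
    exacts [hM d hd, hn]
  have hdet' : ∀ d, (d ∈ D ∨ d = n) → topDet d M ^ 2 = 1 := by
    rintro d (hd | rfl)
    · exact hdet d hd
    · have : IsEmpty {i : Fin d // ¬ (i : ℕ) < d} := ⟨fun i => i.2 i.1.2⟩
      have h := det_eq_topDet_mul hn
      rw [det_isEmpty (A := M.toSquareBlockProp _), mul_one, h1] at h
      rw [← h, one_pow]
  have hblock : M.BlockTriangular b := fun i j hij => by
    have hd := (hb j).1
    exact hM' _ hd i j ((hbd _ hd j).2 le_rfl)
      (not_lt.1 fun h => absurd ((hbd _ hd i).1 h) (not_le.2 hij))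
  -- The squared top determinant at `b i` is the product of the squared block determinants up to `b
  -- i`; by induction all but the last factor are `1`.
  have hsq : ∀ a, (M.toSquareBlock b a).det ^ 2 = 1 := by
    intro a
    induction a using Nat.strong_induction_on with
    | _ a ih =>
    by_cases ha : a ∈ Finset.univ.image b
    · obtain ⟨i, -, rfl⟩ := Finset.mem_image.1 ha
      have h := hdet' _ (hb i).1
      rw [topDet_eq_prod b (hbd _ (hb i).1) hblock, ← Finset.prod_pow,
        Finset.prod_eq_single (b i)] at h
      · rwa [if_pos le_rfl] at h
      · intro a _ ha'
        split_ifs with hle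
        · exact ih a (lt_of_le_of_ne hle ha')
        · exact one_pow _
      · exact fun h => absurd ha h
    · have : IsEmpty {i : Fin n // b i = a} :=
        ⟨fun i => ha (Finset.mem_image.2 ⟨i.1, Finset.mem_univ _, i.2⟩)⟩
      rw [toSquareBlock, toSquareBlockProp, det_isEmpty, one_pow]
  obtain ⟨N, hN, hNb, hNu⟩ := exists_blockTriangular_lift b M hblock hsq
  -- The lift has determinant `±1` and reduces to determinant `1`; the sign is determined since `-1
  -- ≠ 1` modulo `p ≥ 3`.
  have hN1 : N.det = 1 := by
    refine (Int.isUnit_iff.1 hNu).resolve_right fun h => ?_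
    have e : ((Int.castRingHom (ZMod p)) N.det) = M.det := by
      rw [← hN, RingHom.map_det]; rfl
    rw [h, h1, map_neg, map_one] at e
    have : Fact (2 < p) := ⟨hp⟩
    exact ZMod.neg_one_ne_one e
  refine ⟨⟨N, hN1⟩, hN, fun d hd i j hj hi => hNb ?_⟩
  exact lt_of_le_of_lt ((hbd d (.inl hd) j).1 hj)
    (not_le.1 fun h => absurd ((hbd d (.inl hd) i).2 h) (not_lt.2 hi))

end TopBlock

/-! ### Bases adapted to a flag, over a field and over `ℤ`. -/

section AdaptedBases

open Matrix Module

/-- The span of the first `d` standard basis vectors. -/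
def stdSubspace (K : Type*) [Field K] (n d : ℕ) : Submodule K (Fin n → K) where
  carrier := {x | ∀ i : Fin n, d ≤ (i : ℕ) → x i = 0}
  add_mem' hx hy i hi := by simp [hx i hi, hy i hi]
  zero_mem' _ _ := rfl
  smul_mem' c x hx i hi := by simp [hx i hi]

variable {K : Type*} [Field K] {n : ℕ}

theorem finrank_stdSubspace {d : ℕ} (hd : d ≤ n) : finrank K (stdSubspace K n d) = d := by
  let e : stdSubspace K n d ≃ₗ[K] (Fin d → K) :=
    { toFun := fun x i => x.1 (Fin.castLE hd i)
      map_add' := fun _ _ => rfl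
      map_smul' := fun _ _ => rfl
      invFun := fun y => ⟨fun i => if h : (i : ℕ) < d then y ⟨i, h⟩ else 0, fun i hi =>
        dif_neg (not_lt.2 hi)⟩
      left_inv := fun x => by
        refine Subtype.ext (funext fun i => ?_)
        by_cases h : (i : ℕ) < d
        · simp [h]
        · simp [h, x.2 i (not_lt.1 h)]
      right_inv := fun y => by ext i; simp }
  rw [e.finrank_eq, finrank_fin_fun]

theorem single_mem_stdSubspace {d : ℕ} {j : Fin n} (hj : (j : ℕ) < d) :
    (Pi.single j 1 : Fin n → K) ∈ stdSubspace K n d := fun i hi =>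
  Pi.single_eq_of_ne (fun h => by rw [h] at hi; omega) _

theorem lowerLeftZero_iff_map_le {d : ℕ} {A : Matrix (Fin n) (Fin n) K} :
    LowerLeftZero d A ↔ (stdSubspace K n d).map (toLin' A) ≤ stdSubspace K n d := by
  rw [Submodule.map_le_iff_le_comap]
  constructor
  · intro hA x hx i hi
    rw [toLin'_apply, mulVec, dotProduct]
    refine Finset.sum_eq_zero fun j _ => ?_
    rcases lt_or_ge (j : ℕ) d with h | h
    · rw [hA i j h hi, zero_mul]
    · rw [hx j h, mul_zero]
  · intro h i j hj hi
    have := h (single_mem_stdSubspace (K := K) hj) i hi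
    rwa [toLin'_apply, mulVec_single_one] at this

theorem toLin'_injective_of_isUnit {A : Matrix (Fin n) (Fin n) K} (hA : IsUnit A.det) :
    Function.Injective (toLin' A) := by
  intro x y h
  have := congrArg (A⁻¹ *ᵥ ·) h
  simpa [toLin'_apply, mulVec_mulVec, nonsing_inv_mul A hA] using this

theorem finrank_map_toLin' {A : Matrix (Fin n) (Fin n) K} (hA : IsUnit A.det)
    (U : Submodule K (Fin n → K)) : finrank K (U.map (toLin' A)) = finrank K U :=
  (U.equivMapOfInjective _ (toLin'_injective_of_isUnit hA)).symm.finrank_eq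

theorem map_stdSubspace_of_lowerLeftZero {d : ℕ} {A : Matrix (Fin n) (Fin n) K}
    (hA : IsUnit A.det) (h : LowerLeftZero d A) :
    (stdSubspace K n d).map (toLin' A) = stdSubspace K n d :=
  Submodule.eq_of_le_of_finrank_le (lowerLeftZero_iff_map_le.1 h) (finrank_map_toLin' hA _).ge

theorem map_toLin'_mul (A B : Matrix (Fin n) (Fin n) K) (U : Submodule K (Fin n → K)) :
    U.map (toLin' (A * B)) = (U.map (toLin' B)).map (toLin' A) := by
  rw [toLin'_mul, Submodule.map_comp]

/-- A flag has an adapted basis. -/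
theorem exists_adapted_matrix {ι : Type*} (σ : ι → Submodule K (Fin n → K))
    (hσ : ∀ a b, σ a ≤ σ b ∨ σ b ≤ σ a) :
    ∃ A : Matrix (Fin n) (Fin n) K, IsUnit A.det ∧
      ∀ k, (stdSubspace K n (finrank K (σ k))).map (toLin' A) = σ k := by
  classical
  -- `W` is the smallest member of the flag, or the whole space, of dimension greater than `i`.
  -- Taking the `i`-th basis vector in it, outside the span of the earlier ones, makes the first
  -- `finrank K (σ k)` vectors lie in `σ k`.
  have hW : ∀ i, ∃ W : Submodule K (Fin n → K), i < n →
      i < finrank K W ∧ ∀ k, i < finrank K (σ k) → W ≤ σ k := by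
    intro i
    by_cases hi : i < n
    · let T : Set (Submodule K (Fin n → K)) := {U | (U = ⊤ ∨ ∃ k, σ k = U) ∧ i < finrank K U}
      have hT : T.Nonempty := ⟨⊤, .inl rfl, by simpa using hi⟩
      obtain ⟨W, ⟨hW, hiW⟩, hmin⟩ := (measure fun U : Submodule K (Fin n → K) =>
        finrank K U).wf.has_min T hT
      refine ⟨W, fun _ => ⟨hiW, fun k hk => ?_⟩⟩
      have hkW : σ k ≤ W ∨ W ≤ σ k := by
        rcases hW with rfl | ⟨a, rfl⟩
        exacts [.inl le_top, hσ k a]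
      refine hkW.elim (fun h => ?_) id
      have : finrank K W ≤ finrank K (σ k) := not_lt.1 (hmin _ ⟨.inr ⟨k, rfl⟩, hk⟩)
      exact (Submodule.eq_of_le_of_finrank_le h this).ge
    · exact ⟨⊥, fun h => absurd h hi⟩
  choose W hW using hW
  let pick : ℕ → Submodule K (Fin n → K) → (Fin n → K) := fun i S =>
    if h : ∃ x ∈ W i, x ∉ S then h.choose else 0
  obtain ⟨S, hS0, hS⟩ : ∃ S : ℕ → Submodule K (Fin n → K), S 0 = ⊥ ∧
      ∀ i, S (i + 1) = S i ⊔ Submodule.span K {pick i (S i)} :=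
    ⟨fun i => Nat.rec ⊥ (fun i S => S ⊔ Submodule.span K {pick i S}) i, rfl, fun _ => rfl⟩
  have hpick : ∀ i : ℕ, i < n → finrank K (S i) = i → pick i (S i) ∈ W i ∧ pick i (S i) ∉ S i := by
    intro i hi hfin
    have hex : ∃ x ∈ W i, x ∉ S i := Set.not_subset.1 fun h => by
      have := Submodule.finrank_mono (show W i ≤ S i from h)
      have := (hW i hi).1
      omega
    simp only [pick]
    rw [dif_pos hex]
    exact hex.choose_spec
  have hfin : ∀ i : ℕ, i ≤ n → finrank K (S i) = i := by
    intro i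
    induction i with
    | zero => exact fun _ => by rw [hS0, finrank_bot]
    | succ i ih =>
      intro hi
      rw [hS, Submodule.finrank_sup_span_singleton (hpick i (by omega) (ih (by omega))).2,
        ih (by omega)]
  have hle : ∀ d k, d ≤ finrank K (σ k) → S d ≤ σ k := by
    intro d k
    induction d with
    | zero => exact fun _ => hS0 ▸ bot_le
    | succ d ih =>
      intro hd
      have hn : finrank K (σ k) ≤ n := (Submodule.finrank_le _).trans (finrank_fin_fun K).le
      rw [hS, sup_le_iff, Submodule.span_singleton_le_iff_mem]
      exact ⟨ih (by omega), (hW d (by omega)).2 k (by omega)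
        (hpick d (by omega) (hfin d (by omega))).1⟩
  let A : Matrix (Fin n) (Fin n) K := of fun i j => pick j (S j) i
  have hSA : ∀ d, d ≤ n → S d ≤ (stdSubspace K n d).map (toLin' A) := by
    intro d
    induction d with
    | zero => exact fun _ => hS0 ▸ bot_le
    | succ d ih =>
      intro hd
      rw [hS, sup_le_iff, Submodule.span_singleton_le_iff_mem]
      refine ⟨(ih (by omega)).trans (Submodule.map_mono fun x hx i hi => hx i (by omega)),
        ⟨Pi.single ⟨d, hd⟩ 1, single_mem_stdSubspace (Nat.lt_succ_self d), ?_⟩⟩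
      rw [toLin'_apply, mulVec_single_one]
      rfl
  have hA : IsUnit A.det := by
    rw [← isUnit_iff_isUnit_det, ← mulVec_surjective_iff_isUnit]
    intro x
    have hx : x ∈ S n := by
      rw [Submodule.eq_top_of_finrank_eq ((hfin n le_rfl).trans (finrank_fin_fun K).symm)]
      trivial
    obtain ⟨y, -, hy⟩ := hSA n le_rfl hx
    exact ⟨y, hy⟩
  refine ⟨A, hA, fun k => ?_⟩
  have hn : finrank K (σ k) ≤ n := (Submodule.finrank_le _).trans (finrank_fin_fun K).le
  have h1 := hSA _ hn
  have h2 : S (finrank K (σ k)) = σ k :=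
    Submodule.eq_of_le_of_finrank_le (hle _ k le_rfl) (hfin _ hn).ge
  rw [h2] at h1
  refine (Submodule.eq_of_le_of_finrank_le h1 ?_).symm
  rw [finrank_map_toLin' hA, finrank_stdSubspace hn]

/-- Hermite normal form: an integral matrix becomes upper triangular by column operations. -/
theorem exists_mul_upperTriangular (B : Matrix (Fin n) (Fin n) ℤ) (hB : B.det ≠ 0) :
    ∃ g : Matrix.SpecialLinearGroup (Fin n) ℤ,
      ∀ d, LowerLeftZero d (B * (g : Matrix (Fin n) (Fin n) ℤ)) := by
  let M : ℕ → Submodule ℤ (Fin n → ℤ) := fun i =>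
    { carrier := {x | ∀ j : Fin n, i ≤ (j : ℕ) → (B *ᵥ x) j = 0}
      add_mem' := fun hx hy j hj => by
        rw [mulVec_add, Pi.add_apply, hx j hj, hy j hj, add_zero]
      zero_mem' := fun j _ => by rw [mulVec_zero]; rfl
      smul_mem' := fun c x hx j hj => by
        rw [mulVec_smul, Pi.smul_apply, hx j hj, smul_zero] }
  -- The `i`-th coordinates of `B x`, for `x` in `M (i + 1)`, form an ideal of `ℤ`; `v` attains a
  -- generator. Subtracting multiples of these vectors moves down the filtration `M`, which ends at
  -- `0` because `B` is nonsingular.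
  have hv : ∀ i : Fin n, ∃ v ∈ M (i + 1), ∀ x ∈ M (i + 1), ∃ c : ℤ,
      (B *ᵥ x) i = c * (B *ᵥ v) i := by
    intro i
    let I : Ideal ℤ := (M (i + 1)).map (LinearMap.proj i ∘ₗ mulVecLin B)
    obtain ⟨a, ha⟩ := (IsPrincipalIdealRing.principal I).principal
    obtain ⟨v, hv, hva⟩ : a ∈ I := by rw [ha]; exact Submodule.mem_span_singleton_self a
    refine ⟨v, hv, fun x hx => ?_⟩
    have hxI : (B *ᵥ x) i ∈ I := ⟨x, hx, rfl⟩
    rw [ha] at hxI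
    obtain ⟨c, hc⟩ := Submodule.mem_span_singleton.1 hxI
    refine ⟨c, ?_⟩
    rw [← hc, ← hva]
    rfl
  choose v hvM hv using hv
  have hspan : ∀ i, i ≤ n → M i ≤ Submodule.span ℤ (Set.range v) := by
    intro i
    induction i with
    | zero =>
      intro _ x hx
      have : B *ᵥ x = 0 := funext fun j => hx j (Nat.zero_le _)
      rw [eq_zero_of_mulVec_eq_zero hB this]
      exact zero_mem _
    | succ i ih =>
      intro hi x hx
      obtain ⟨c, hc⟩ := hv ⟨i, hi⟩ x hx
      have hmem : x - c • v ⟨i, hi⟩ ∈ M i := fun j hj => by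
        rw [mulVec_sub, mulVec_smul, Pi.sub_apply, Pi.smul_apply]
        rcases hj.eq_or_lt with h | h
        · obtain rfl : (⟨i, hi⟩ : Fin n) = j := Fin.ext h
          rw [hc, smul_eq_mul, sub_self]
        · rw [hx j h, hvM ⟨i, hi⟩ j h, smul_zero, sub_self]
      have := add_mem (ih (by omega) hmem)
        (Submodule.smul_mem _ c (Submodule.subset_span ⟨⟨i, hi⟩, rfl⟩))
      rwa [sub_add_cancel] at this
  let G : Matrix (Fin n) (Fin n) ℤ := of fun i j => v j i
  have hG : IsUnit G.det := by
    rw [← isUnit_iff_isUnit_det, ← mulVec_surjective_iff_isUnit]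
    intro x
    have hx := hspan n le_rfl (show x ∈ M n from fun j hj => absurd j.2 (not_lt.2 hj))
    obtain ⟨c, hc⟩ := (Submodule.mem_span_range_iff_exists_fun ℤ).1 hx
    refine ⟨c, ?_⟩
    rw [← hc]
    ext i
    simp [mulVec, dotProduct, G, mul_comm]
  have hBG : ∀ d, LowerLeftZero d (B * G) := fun d i j hj hi => hvM j i (by omega)
  rcases Int.isUnit_iff.1 hG with h | h
  · exact ⟨⟨G, h⟩, hBG⟩
  · rcases isEmpty_or_nonempty (Fin n) with hn | ⟨⟨k⟩⟩
    · rw [det_isEmpty] at h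
      exact absurd h (by norm_num)
    -- Negating one column corrects the determinant and preserves the triangular shape.
    · let D : Matrix (Fin n) (Fin n) ℤ := diagonal fun i => if i = k then -1 else 1
      have hD : D.det = -1 := by simp [D, Finset.prod_ite_eq']
      refine ⟨⟨G * D, by rw [det_mul, h, hD]; norm_num⟩, fun d => ?_⟩
      change LowerLeftZero d (B * (G * D))
      rw [← mul_assoc]
      exact (hBG d).mul fun i j hj hi => diagonal_apply_ne _ fun h => by rw [h] at hi; omega

/-- A flag of rational subspaces has an adapted integral basis. -/
theorem exists_adapted_specialLinearGroup {ι : Type*} (σ : ι → Submodule ℚ (Fin n → ℚ))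
    (hσ : ∀ a b, σ a ≤ σ b ∨ σ b ≤ σ a) :
    ∃ g : Matrix.SpecialLinearGroup (Fin n) ℤ, ∀ k, (stdSubspace ℚ n (finrank ℚ (σ k))).map
      (toLin' ((g : Matrix (Fin n) (Fin n) ℤ).map (Int.castRingHom ℚ))) = σ k := by
  obtain ⟨A, hA, hσA⟩ := exists_adapted_matrix σ hσ
  let f := Int.castRingHom ℚ
  -- Clearing denominators in `A⁻¹` and triangularising by `g` makes `A⁻¹ g` upper triangular, so `g
  -- = A (A⁻¹ g)` sends the standard subspaces to the same places as `A`.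
  have hB : ((A⁻¹.den : ℚ)⁻¹) • A⁻¹.num.map f = A⁻¹ := inv_denom_smul_num A⁻¹
  have hB0 : A⁻¹.num.det ≠ 0 := fun h => by
    have h1 : (A⁻¹.num.map f).det = 0 := by
      rw [← RingHom.mapMatrix_apply, ← RingHom.map_det, h, map_zero]
    have h2 : A⁻¹.det = 0 := by rw [← hB, det_smul, h1, mul_zero]
    exact (isUnit_nonsing_inv_det A hA).ne_zero h2
  obtain ⟨g, hg⟩ := exists_mul_upperTriangular _ hB0
  have hX : ∀ d, LowerLeftZero d (A⁻¹ * (g : Matrix (Fin n) (Fin n) ℤ).map f) := fun d i j hj hi => by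
    rw [← hB, smul_mul, ← Matrix.map_mul, Matrix.smul_apply, map_apply, hg d i j hj hi, map_zero,
      smul_zero]
  have hgu : IsUnit ((g : Matrix (Fin n) (Fin n) ℤ).map f).det := by
    rw [← RingHom.mapMatrix_apply, ← RingHom.map_det, Matrix.SpecialLinearGroup.det_coe, map_one]
    exact isUnit_one
  refine ⟨g, fun k => ?_⟩
  have e : (g : Matrix (Fin n) (Fin n) ℤ).map f =
      A * (A⁻¹ * (g : Matrix (Fin n) (Fin n) ℤ).map f) := by
    rw [mul_nonsing_inv_cancel_left _ _ hA]
  change Submodule.map (toLin' ((g : Matrix (Fin n) (Fin n) ℤ).map f)) _ = _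
  rw [e, map_toLin'_mul, map_stdSubspace_of_lowerLeftZero _ (hX _), hσA]
  rw [det_mul]
  exact (isUnit_nonsing_inv_det A hA).mul hgu

end AdaptedBases

/-! ### Reducing rational subspaces to labelled subspaces modulo `p`. -/

section Reduction

open Matrix Module
open scoped Classical

variable {n : ℕ}

section Orientation

variable {F : Type*} [Field F]

/-- A reference basis of a subspace, extended to a basis of the whole space. -/
noncomputable def referenceMatrix (U : Submodule F (Fin n → F)) : Matrix (Fin n) (Fin n) F :=
  (exists_adapted_matrix (fun _ : Unit => U) fun _ _ => .inl le_rfl).choose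

theorem isUnit_det_referenceMatrix (U : Submodule F (Fin n → F)) :
    IsUnit (referenceMatrix U).det :=
  (exists_adapted_matrix (fun _ : Unit => U) fun _ _ => .inl le_rfl).choose_spec.1

theorem map_referenceMatrix (U : Submodule F (Fin n → F)) :
    (stdSubspace F n (finrank F U)).map (toLin' (referenceMatrix U)) = U :=
  (exists_adapted_matrix (fun _ : Unit => U) fun _ _ => .inl le_rfl).choose_spec.2 ()

/-- The square of the determinant of the first `d` columns of `g`, relative to the reference basis
of their span.  It determines the orientation of this span up to sign. -/
noncomputable def orientationLabel (d : ℕ) (g : Matrix (Fin n) (Fin n) F) : F :=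
  topDet d ((referenceMatrix ((stdSubspace F n d).map (toLin' g)))⁻¹ * g) ^ 2

theorem lowerLeftZero_inv_mul {d : ℕ} {g h : Matrix (Fin n) (Fin n) F} (hg : IsUnit g.det)
    (e : (stdSubspace F n d).map (toLin' g) = (stdSubspace F n d).map (toLin' h)) :
    LowerLeftZero d (g⁻¹ * h) := by
  rw [lowerLeftZero_iff_map_le, map_toLin'_mul, ← e, ← map_toLin'_mul, nonsing_inv_mul _ hg,
    toLin'_one, Submodule.map_id]

theorem lowerLeftZero_referenceMatrix_inv_mul {d : ℕ} (hd : d ≤ n) {g : Matrix (Fin n) (Fin n) F}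
    (hg : IsUnit g.det) :
    LowerLeftZero d ((referenceMatrix ((stdSubspace F n d).map (toLin' g)))⁻¹ * g) := by
  refine lowerLeftZero_inv_mul (isUnit_det_referenceMatrix _) ?_
  have := map_referenceMatrix ((stdSubspace F n d).map (toLin' g))
  rwa [finrank_map_toLin' hg, finrank_stdSubspace hd] at this

theorem topDet_ne_zero {d : ℕ} {g : Matrix (Fin n) (Fin n) F} (hg : IsUnit g.det)
    (h : LowerLeftZero d g) : topDet d g ≠ 0 := by
  rw [det_eq_topDet_mul h] at hg
  exact (isUnit_of_mul_isUnit_left hg).ne_zero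

theorem exists_orientationLabel_eq {d : ℕ} (hd : d ≤ n) {g : Matrix (Fin n) (Fin n) F}
    (hg : IsUnit g.det) : ∃ u : Fˣ, (u : F) ^ 2 = orientationLabel d g :=
  ⟨Units.mk0 _ (topDet_ne_zero (by
    rw [det_mul]
    exact (isUnit_nonsing_inv_det _ (isUnit_det_referenceMatrix _)).mul hg)
    (lowerLeftZero_referenceMatrix_inv_mul hd hg)), rfl⟩

/-- Such a `k` changes the basis of the subspace but not the subspace, so the reference matrix stays
the same. -/
theorem orientationLabel_mul {d : ℕ} {g k : Matrix (Fin n) (Fin n) F}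
    (hk : IsUnit k.det) (h : LowerLeftZero d k) :
    orientationLabel d (g * k) = orientationLabel d g * topDet d k ^ 2 := by
  rw [orientationLabel, map_toLin'_mul, map_stdSubspace_of_lowerLeftZero hk h, ← mul_assoc,
    topDet_mul _ h, mul_pow, orientationLabel]

theorem topDet_sq_eq_one {d : ℕ} (hd : d ≤ n) {g k : Matrix (Fin n) (Fin n) F}
    (hg : IsUnit g.det) (hk : IsUnit k.det) (h : LowerLeftZero d k)
    (e : orientationLabel d (g * k) = orientationLabel d g) : topDet d k ^ 2 = 1 := by
  obtain ⟨u, hu⟩ := exists_orientationLabel_eq hd hg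
  rw [orientationLabel_mul hk h, ← hu] at e
  exact mul_left_cancel₀ (pow_ne_zero 2 u.ne_zero) (e.trans (mul_one _).symm)

theorem bot_lt_map_stdSubspace {d : ℕ} (h0 : 0 < d) (hd : d ≤ n) {g : Matrix (Fin n) (Fin n) F}
    (hg : IsUnit g.det) : ⊥ < (stdSubspace F n d).map (toLin' g) :=
  bot_lt_iff_ne_bot.2 fun h => by
    have := finrank_map_toLin' hg (stdSubspace F n d)
    rw [h, finrank_bot, finrank_stdSubspace hd] at this
    omega

theorem map_stdSubspace_lt_top {d : ℕ} (hd : d < n) {g : Matrix (Fin n) (Fin n) F}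
    (hg : IsUnit g.det) : (stdSubspace F n d).map (toLin' g) < ⊤ :=
  lt_top_iff_ne_top.2 fun h => by
    have := finrank_map_toLin' hg (stdSubspace F n d)
    rw [h, finrank_top, finrank_fin_fun, finrank_stdSubspace hd.le] at this
    omega

theorem map_stdSubspace_lt {d d' : ℕ} (h : d < d') (hd : d' ≤ n) {g : Matrix (Fin n) (Fin n) F}
    (hg : IsUnit g.det) :
    (stdSubspace F n d).map (toLin' g) < (stdSubspace F n d').map (toLin' g) := by
  refine lt_of_le_of_ne (Submodule.map_mono fun x hx i hi => hx i (by omega)) fun e => ?_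
  have h1 := finrank_map_toLin' hg (stdSubspace F n d)
  have h2 := finrank_map_toLin' hg (stdSubspace F n d')
  rw [e, h2, finrank_stdSubspace hd, finrank_stdSubspace (by omega)] at h1
  omega

end Orientation

/-- The image of an integral unimodular matrix in the matrices over `R`. -/
def castMatrix (R : Type*) [CommRing R] (g : Matrix.SpecialLinearGroup (Fin n) ℤ) :
    Matrix (Fin n) (Fin n) R :=
  (g : Matrix (Fin n) (Fin n) ℤ).map (Int.castRingHom R)

theorem castMatrix_mul {R : Type*} [CommRing R] (g h : Matrix.SpecialLinearGroup (Fin n) ℤ) :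
    castMatrix R (g * h) = castMatrix R g * castMatrix R h := by
  rw [castMatrix, Matrix.SpecialLinearGroup.coe_mul, Matrix.map_mul]
  rfl

theorem castMatrix_one {R : Type*} [CommRing R] :
    castMatrix R (1 : Matrix.SpecialLinearGroup (Fin n) ℤ) = 1 := by
  rw [castMatrix, Matrix.SpecialLinearGroup.coe_one, Matrix.map_one _ (map_zero _) (map_one _)]

theorem det_castMatrix {R : Type*} [CommRing R] (g : Matrix.SpecialLinearGroup (Fin n) ℤ) :
    (castMatrix R g).det = 1 := by
  rw [castMatrix, ← RingHom.mapMatrix_apply, ← RingHom.map_det,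
    Matrix.SpecialLinearGroup.det_coe, map_one]

theorem isUnit_det_castMatrix {R : Type*} [CommRing R]
    (g : Matrix.SpecialLinearGroup (Fin n) ℤ) : IsUnit (castMatrix R g).det := by
  rw [det_castMatrix]
  exact isUnit_one

theorem castMatrix_inv {R : Type*} [CommRing R] (g : Matrix.SpecialLinearGroup (Fin n) ℤ) :
    castMatrix R g⁻¹ = (castMatrix R g)⁻¹ :=
  (inv_eq_left_inv (by rw [← castMatrix_mul, inv_mul_cancel, castMatrix_one])).symm

theorem lowerLeftZero_of_castMatrix_rat {d : ℕ} {g : Matrix.SpecialLinearGroup (Fin n) ℤ}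
    (h : LowerLeftZero d (castMatrix ℚ g)) :
    LowerLeftZero d (g : Matrix (Fin n) (Fin n) ℤ) := fun i j hj hi => by
  have := h i j hj hi
  rwa [castMatrix, map_apply, eq_intCast, Int.cast_eq_zero] at this

variable (p : ℕ) [Fact p.Prime]

/-- The reduction modulo `p` of a rational subspace, with the label of its orientation. -/
noncomputable def reduceSubspace (W : Submodule ℚ (Fin n → ℚ)) :
    Submodule (ZMod p) (Fin n → ZMod p) × ZMod p :=
  let g := (exists_adapted_specialLinearGroup (fun _ : Unit => W) fun _ _ => .inl le_rfl).choose
  ((stdSubspace (ZMod p) n (finrank ℚ W)).map (toLin' (castMatrix (ZMod p) g)),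
    orientationLabel (finrank ℚ W) (castMatrix (ZMod p) g))

/-- Independence of the chosen adapted basis: two integral ones differ by an integral matrix
preserving the standard subspace, whose top block has determinant `±1`, and the label is a square.
-/
theorem reduceSubspace_map {d : ℕ} (hd : d ≤ n) (g : Matrix.SpecialLinearGroup (Fin n) ℤ) :
    reduceSubspace p ((stdSubspace ℚ n d).map (toLin' (castMatrix ℚ g))) =
      ((stdSubspace (ZMod p) n d).map (toLin' (castMatrix (ZMod p) g)),
        orientationLabel d (castMatrix (ZMod p) g)) := by
  set W := (stdSubspace ℚ n d).map (toLin' (castMatrix ℚ g)) with hW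
  have hex := exists_adapted_specialLinearGroup (fun _ : Unit => W) fun _ _ => .inl le_rfl
  have hfin : finrank ℚ W = d := by
    rw [hW, finrank_map_toLin' (isUnit_det_castMatrix g), finrank_stdSubspace hd]
  have hg0 := hex.choose_spec ()
  change ((stdSubspace (ZMod p) n (finrank ℚ W)).map (toLin' (castMatrix (ZMod p) hex.choose)),
    orientationLabel (finrank ℚ W) (castMatrix (ZMod p) hex.choose)) = _
  generalize hex.choose = g0 at hg0 ⊢
  rw [hfin] at hg0 ⊢
  let k := g0⁻¹ * g
  have hgk : g = g0 * k := (mul_inv_cancel_left _ _).symm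
  have hk : LowerLeftZero d (k : Matrix (Fin n) (Fin n) ℤ) := lowerLeftZero_of_castMatrix_rat (by
    rw [castMatrix_mul, castMatrix_inv]
    exact lowerLeftZero_inv_mul (isUnit_det_castMatrix _) hg0)
  have hkp : LowerLeftZero d (castMatrix (ZMod p) k) := hk.map _
  have hsq : topDet d (castMatrix (ZMod p) k) ^ 2 = 1 := by
    rw [castMatrix, topDet_map, ← map_pow, topDet_sq_of_isUnit hk (by simp), map_one]
  rw [hgk, castMatrix_mul, orientationLabel_mul (isUnit_det_castMatrix _) hkp, hsq, mul_one,
    map_toLin'_mul, map_stdSubspace_of_lowerLeftZero (isUnit_det_castMatrix _) hkp]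

/-- The labels: the nonzero squares modulo `p`. -/
noncomputable def squareLabels : Finset (ZMod p) :=
  Finset.univ.image fun u : (ZMod p)ˣ => (u : ZMod p) ^ 2

/-- Squaring is two-to-one on the units, with fibres `{u, -u}`. -/
theorem two_mul_card_squareLabels (hp : 3 ≤ p) : 2 * (squareLabels p).card = p - 1 := by
  have h1 := Finset.card_eq_sum_card_image (fun u : (ZMod p)ˣ => (u : ZMod p) ^ 2) Finset.univ
  rw [Finset.card_univ, ZMod.card_units] at h1
  have : Fact (2 < p) := ⟨hp⟩
  rw [h1, Finset.sum_const_nat (m := 2), mul_comm]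
  · rfl
  intro x hx
  obtain ⟨u, -, rfl⟩ := Finset.mem_image.1 hx
  rw [Finset.card_eq_two]
  refine ⟨u, -u, fun h => ?_, ?_⟩
  · have h2 : (u : ZMod p) = -u := by
      rw [← Units.val_neg, ← h]
    have h3 : (u : ZMod p) * (-1) = u * 1 := by rw [mul_one, mul_neg_one, ← h2]
    exact ZMod.neg_one_ne_one (mul_left_cancel₀ u.ne_zero h3)
  · ext v
    simp [sq_eq_sq_iff_eq_or_eq_neg, Units.ext_iff]

variable {p}

theorem orientationLabel_mem_squareLabels {d : ℕ} (hd : d ≤ n)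
    {g : Matrix (Fin n) (Fin n) (ZMod p)} (hg : IsUnit g.det) :
    orientationLabel d g ∈ squareLabels p := by
  obtain ⟨u, hu⟩ := exists_orientationLabel_eq hd hg
  exact Finset.mem_image.2 ⟨u, Finset.mem_univ _, hu⟩

theorem prod_telescope (P : ℕ → (ZMod p)ˣ) (h0 : P 0 = 1) {d : ℕ} (hd : d ≤ n) :
    ∏ i : {i : Fin n // (i : ℕ) < d}, P (i.1 + 1) / P i.1 = P d := by
  have h := Finset.prod_range_div P d
  rw [h0, div_one, ← Fin.prod_univ_eq_prod_range] at h
  rw [← h]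
  exact Fintype.prod_equiv
    { toFun := fun i => ⟨i.1, i.2⟩
      invFun := fun i => ⟨Fin.castLE hd i, i.2⟩
      left_inv := fun _ => rfl
      right_inv := fun _ => rfl } _ _ fun _ => rfl

/-- A flag of labelled subspaces is the reduction of a flag of rational subspaces. -/
theorem exists_lift_labelled_flag {j : ℕ} (U : Fin j → Submodule (ZMod p) (Fin n → ZMod p))
    (hU : StrictMono U) (hU0 : ∀ i, ⊥ < U i ∧ U i < ⊤) (l : Fin j → ZMod p)
    (hl : ∀ i, l i ∈ squareLabels p) :
    ∃ g : Matrix.SpecialLinearGroup (Fin n) ℤ, ∀ i,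
      (stdSubspace (ZMod p) n (finrank (ZMod p) (U i))).map (toLin' (castMatrix (ZMod p) g)) =
        U i ∧ orientationLabel (finrank (ZMod p) (U i)) (castMatrix (ZMod p) g) = l i := by
  obtain ⟨A, hA, hAU⟩ := exists_adapted_matrix U fun a b =>
    (le_total a b).imp (fun h => hU.monotone h) fun h => hU.monotone h
  let d : Fin j → ℕ := fun i => finrank (ZMod p) (U i)
  have hd : StrictMono d := fun a b h => Submodule.finrank_lt_finrank_of_lt (hU h)
  have hd0 : ∀ i, 0 < d i := fun i => by
    have := Submodule.finrank_lt_finrank_of_lt (hU0 i).1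
    rwa [finrank_bot] at this
  have hdn : ∀ i, d i < n := fun i => by
    have := Submodule.finrank_lt_finrank_of_lt (hU0 i).2
    rwa [finrank_top, finrank_fin_fun] at this
  choose w hw using fun i => exists_orientationLabel_eq (hdn i).le hA
  choose u _ hu using fun i => Finset.mem_image.1 (hl i)
  -- `P m` prescribes the product of the first `m` diagonal entries of `T`. At `d i` it is a square
  -- root of the correction from the label of `A` to `l i`; at `n` it is the inverse of `det A`, so
  -- that `A * T` has determinant `1`. The values at other positive `m` do not matter.
  let P : ℕ → (ZMod p)ˣ := fun m =>
    if h : ∃ i, d i = m then u h.choose / w h.choose else if m = 0 then 1 else hA.unit⁻¹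
  have hP0 : P 0 = 1 := by
    have : ¬ ∃ i, d i = 0 := fun ⟨i, hi⟩ => (hd0 i).ne' hi
    simp [P, this]
  have hPd : ∀ i, P (d i) = u i / w i := fun i => by
    have hex : ∃ i', d i' = d i := ⟨i, rfl⟩
    have : hex.choose = i := hd.injective hex.choose_spec
    simp only [P]
    rw [dif_pos hex, this]
  by_cases hn : n = 0
  · exact ⟨1, fun i => absurd (hdn i) (by omega)⟩
  have hPn : P n = hA.unit⁻¹ := by
    have : ¬ ∃ i, d i = n := fun ⟨i, hi⟩ => (hdn i).ne hi
    simp [P, this, hn]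
  let T : Matrix (Fin n) (Fin n) (ZMod p) :=
    diagonal fun i => ((P (i + 1) / P i : (ZMod p)ˣ) : ZMod p)
  have hTd : ∀ d, LowerLeftZero d T := fun d i j hj hi =>
    diagonal_apply_ne _ fun h => by rw [h] at hi; omega
  have hTtop : ∀ i, topDet (d i) T = u i / w i := fun i => by
    rw [topDet_diagonal, ← Units.coe_prod, prod_telescope P hP0 (hdn i).le, hPd,
      Units.val_div_eq_div_val]
  have hTdet : T.det = (P n : ZMod p) := by
    rw [det_diagonal, ← Units.coe_prod,
      Fin.prod_univ_eq_prod_range (fun i => P (i + 1) / P i) n, Finset.prod_range_div, hP0, div_one]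
  have hT : IsUnit T.det := hTdet ▸ (P n).isUnit
  have hAT : (A * T).det = 1 := by
    rw [det_mul, hTdet, hPn]
    exact hA.mul_val_inv
  obtain ⟨g, hg⟩ := map_intCast_zmod_surjective (ι := Fin n)
    (⟨A * T, hAT⟩ : Matrix.SpecialLinearGroup (Fin n) (ZMod p))
  have hg' : castMatrix (ZMod p) g = A * T := congrArg Subtype.val hg
  refine ⟨g, fun i => ?_⟩
  rw [hg', map_toLin'_mul, map_stdSubspace_of_lowerLeftZero hT (hTd _), hAU,
    orientationLabel_mul hT (hTd _)]
  refine ⟨rfl, ?_⟩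
  change orientationLabel (d i) A * topDet (d i) T ^ 2 = l i
  rw [hTtop, ← hw, ← hu, div_pow, mul_div_cancel₀ _ (pow_ne_zero 2 (w i).ne_zero)]

end Reduction

/-! ### Orbits of flags correspond to chains of labelled subspaces. -/

section QuotientFlags

open Matrix Module
open scoped Classical

variable {n p : ℕ}

theorem congruenceAction_coe (γ : principalCongruenceSubgroup n p)
    (W : TitsPoset ℚ (Fin n → ℚ)) :
    ((congruenceAction n p γ W).1 : Submodule ℚ (Fin n → ℚ)) =
      W.1.map (toLin' (castMatrix ℚ γ.1)) := rfl

theorem castMatrix_eq_one_iff {g : Matrix.SpecialLinearGroup (Fin n) ℤ} :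
    g ∈ principalCongruenceSubgroup n p ↔ castMatrix (ZMod p) g = 1 :=
  ⟨fun h => by
    have h' : Matrix.SpecialLinearGroup.map (Int.castRingHom (ZMod p)) g = 1 :=
      MonoidHom.mem_ker.1 h
    exact congrArg (fun A : Matrix.SpecialLinearGroup (Fin n) (ZMod p) =>
      (A : Matrix (Fin n) (Fin n) (ZMod p))) h',
    fun h => MonoidHom.mem_ker.2 (specialLinearGroup_ext h)⟩

variable [Fact p.Prime]

theorem exists_adapted_flag {j : ℕ} (σ : PosetFlag (TitsPoset ℚ (Fin n → ℚ)) j) :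
    ∃ (d : Fin j → ℕ) (g : Matrix.SpecialLinearGroup (Fin n) ℤ), StrictMono d ∧
      (∀ i, 0 < d i ∧ d i < n) ∧
      ∀ i, (σ i).1 = (stdSubspace ℚ n (d i)).map (toLin' (castMatrix ℚ g)) := by
  obtain ⟨g, hg⟩ := exists_adapted_specialLinearGroup (fun i => (σ i).1) fun a b =>
    (le_total a b).imp (fun h => σ.monotone h) fun h => σ.monotone h
  refine ⟨fun i => finrank ℚ (σ i).1, g, fun a b h =>
    Submodule.finrank_lt_finrank_of_lt (σ.strictMono h), fun i => ⟨?_, ?_⟩, fun i => (hg i).symm⟩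
  · exact Nat.pos_of_ne_zero fun h => (σ i).2.1 (Submodule.finrank_eq_zero.1 h)
  · have := Submodule.finrank_lt (σ i).2.2
    rwa [finrank_fin_fun] at this

variable (p) in
/-- The reduction of a flag, as a chain of labelled subspaces. -/
noncomputable def reduceFlag {j : ℕ} (σ : PosetFlag (TitsPoset ℚ (Fin n → ℚ)) j) :
    Finset (Submodule (ZMod p) (Fin n → ZMod p) × ZMod p) :=
  Finset.univ.image fun i => reduceSubspace p (σ i).1

theorem reduceSubspace_lt {j : ℕ} (σ : PosetFlag (TitsPoset ℚ (Fin n → ℚ)) j) {a b : Fin j}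
    (h : a < b) : labelledLT _ _ _ (reduceSubspace p (σ a).1) (reduceSubspace p (σ b).1) := by
  obtain ⟨d, g, hd, hdn, hσ⟩ := exists_adapted_flag σ
  rw [hσ, hσ, reduceSubspace_map p (hdn a).2.le, reduceSubspace_map p (hdn b).2.le]
  exact map_stdSubspace_lt (hd h) (hdn b).2.le (isUnit_det_castMatrix g)

theorem reduceSubspace_injective {j : ℕ} (σ : PosetFlag (TitsPoset ℚ (Fin n → ℚ)) j) :
    Function.Injective fun i => reduceSubspace p (σ i).1 := by
  intro a b h
  dsimp only at h
  by_contra hab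
  rcases lt_or_gt_of_ne hab with h' | h'
  · have := reduceSubspace_lt (p := p) σ h'
    rw [h] at this
    exact irrefl (r := labelledLT _ _ _) _ this
  · have := reduceSubspace_lt (p := p) σ h'
    rw [h] at this
    exact irrefl (r := labelledLT _ _ _) _ this

theorem card_reduceFlag {j : ℕ} (σ : PosetFlag (TitsPoset ℚ (Fin n → ℚ)) j) :
    (reduceFlag p σ).card = j := by
  rw [reduceFlag, Finset.card_image_of_injective _ (reduceSubspace_injective σ), Finset.card_univ,
    Fintype.card_fin]

theorem isChain_reduceFlag {j : ℕ} (σ : PosetFlag (TitsPoset ℚ (Fin n → ℚ)) j) :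
    IsChain (labelledLT (ZMod p) (Fin n → ZMod p) (ZMod p))
      (↑(reduceFlag p σ) : Set (Submodule (ZMod p) (Fin n → ZMod p) × ZMod p)) := by
  intro x hx y hy hxy
  obtain ⟨a, -, rfl⟩ := Finset.mem_image.1 hx
  obtain ⟨b, -, rfl⟩ := Finset.mem_image.1 hy
  rcases lt_trichotomy a b with h | h | h
  · exact .inl (reduceSubspace_lt σ h)
  · exact absurd (by rw [h]) hxy
  · exact .inr (reduceSubspace_lt σ h)

theorem reduceFlag_subset {j : ℕ} (σ : PosetFlag (TitsPoset ℚ (Fin n → ℚ)) j) :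
    reduceFlag p σ ⊆ labelledInterval (squareLabels p) ⊥ ⊤ := by
  intro x hx
  obtain ⟨a, -, rfl⟩ := Finset.mem_image.1 hx
  obtain ⟨d, g, hd, hdn, hσ⟩ := exists_adapted_flag σ
  have hg := isUnit_det_castMatrix (R := ZMod p) g
  rw [hσ, reduceSubspace_map p (hdn a).2.le, mem_labelledInterval]
  exact ⟨⟨bot_lt_map_stdSubspace (hdn a).1 (hdn a).2.le hg, map_stdSubspace_lt_top (hdn a).2 hg⟩,
    orientationLabel_mem_squareLabels (hdn a).2.le hg⟩

/-- If `g` is adapted to `σ` then `γ g` is adapted to `τ`, and the two agree modulo `p`. -/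
theorem reduceFlag_eq_of_rel {j : ℕ} {σ τ : PosetFlag (TitsPoset ℚ (Fin n → ℚ)) j}
    (γ : principalCongruenceSubgroup n p) (h : ∀ i, congruenceAction n p γ (σ i) = τ i) :
    reduceFlag p σ = reduceFlag p τ := by
  obtain ⟨d, g, hd, hdn, hσ⟩ := exists_adapted_flag σ
  refine Finset.image_congr fun i _ => ?_
  rw [← h, congruenceAction_coe, hσ, ← map_toLin'_mul, ← castMatrix_mul,
    reduceSubspace_map p (hdn i).2.le, reduceSubspace_map p (hdn i).2.le, castMatrix_mul,
    castMatrix_eq_one_iff.1 γ.2, one_mul]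

theorem finrank_reduceSubspace_strictMono {j : ℕ}
    (σ : PosetFlag (TitsPoset ℚ (Fin n → ℚ)) j) :
    StrictMono fun i => finrank (ZMod p) (reduceSubspace p (σ i).1).1 := fun _ _ h =>
  Submodule.finrank_lt_finrank_of_lt (reduceSubspace_lt σ h)

/-- Dimension recovers the order: strictly increasing dimension sequences with the same range
coincide. -/
theorem reduceSubspace_eq_of_reduceFlag_eq {j : ℕ}
    {σ τ : PosetFlag (TitsPoset ℚ (Fin n → ℚ)) j} (h : reduceFlag p σ = reduceFlag p τ)
    (i : Fin j) : reduceSubspace p (σ i).1 = reduceSubspace p (τ i).1 := by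
  have hσ := finrank_reduceSubspace_strictMono (p := p) σ
  have hτ := finrank_reduceSubspace_strictMono (p := p) τ
  have hr : ∀ {σ τ : PosetFlag (TitsPoset ℚ (Fin n → ℚ)) j}, reduceFlag p σ = reduceFlag p τ →
      Set.range (fun i => finrank (ZMod p) (reduceSubspace p (σ i).1).1) ⊆
        Set.range fun i => finrank (ZMod p) (reduceSubspace p (τ i).1).1 := by
    rintro σ τ h _ ⟨a, rfl⟩
    have ha : reduceSubspace p (σ a).1 ∈ reduceFlag p τ :=
      h ▸ Finset.mem_image_of_mem _ (Finset.mem_univ a)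
    obtain ⟨b, -, hb⟩ := Finset.mem_image.1 ha
    exact ⟨b, by dsimp only; rw [hb]⟩
  have he := (StrictMono.range_inj hσ hτ).1 ((hr h).antisymm (hr h.symm))
  have hi : reduceSubspace p (σ i).1 ∈ reduceFlag p τ :=
    h ▸ Finset.mem_image_of_mem _ (Finset.mem_univ i)
  obtain ⟨b, -, hb⟩ := Finset.mem_image.1 hi
  have : b = i := hτ.injective (by
    have := congrFun he i
    rw [hb, this])
  rw [← hb, this]

/-- For adapted bases `g` and `g'`, the matrix `g⁻¹ g'` modulo `p` stabilizes the standard flag with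
block determinants `±1`. It lifts to some integral `N` stabilizing the same flag, and `g' N⁻¹ g⁻¹`
is trivial modulo `p` and carries `σ` to `τ`. -/
theorem exists_rel_of_reduceFlag_eq (hp : 3 ≤ p) {j : ℕ}
    {σ τ : PosetFlag (TitsPoset ℚ (Fin n → ℚ)) j} (h : reduceFlag p σ = reduceFlag p τ) :
    ∃ γ : principalCongruenceSubgroup n p, ∀ i, congruenceAction n p γ (σ i) = τ i := by
  have h' := reduceSubspace_eq_of_reduceFlag_eq h
  obtain ⟨d, g, hd, hdn, hσ⟩ := exists_adapted_flag σ
  obtain ⟨d', g', hd', hdn', hτ⟩ := exists_adapted_flag τ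
  have hg := isUnit_det_castMatrix (R := ZMod p) g
  have hg' := isUnit_det_castMatrix (R := ZMod p) g'
  have hred : ∀ i, ((stdSubspace (ZMod p) n (d i)).map (toLin' (castMatrix (ZMod p) g)),
        orientationLabel (d i) (castMatrix (ZMod p) g)) =
      ((stdSubspace (ZMod p) n (d' i)).map (toLin' (castMatrix (ZMod p) g')),
        orientationLabel (d' i) (castMatrix (ZMod p) g')) := fun i => by
    rw [← reduceSubspace_map p (hdn i).2.le, ← reduceSubspace_map p (hdn' i).2.le, ← hσ, ← hτ, h']
  have hdd : d = d' := funext fun i => by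
    have := congrArg (fun U : Submodule (ZMod p) (Fin n → ZMod p) => finrank (ZMod p) U)
      (congrArg Prod.fst (hred i))
    dsimp only at this
    rwa [finrank_map_toLin' hg, finrank_map_toLin' hg', finrank_stdSubspace (hdn i).2.le,
      finrank_stdSubspace (hdn' i).2.le] at this
  subst hdd
  let k := g⁻¹ * g'
  have hgk : g' = g * k := (mul_inv_cancel_left _ _).symm
  have hk := isUnit_det_castMatrix (R := ZMod p) k
  have hkd : ∀ i, LowerLeftZero (d i) (castMatrix (ZMod p) k) := fun i => by
    rw [castMatrix_mul, castMatrix_inv]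
    exact lowerLeftZero_inv_mul hg (congrArg Prod.fst (hred i))
  have hsq : ∀ i, topDet (d i) (castMatrix (ZMod p) k) ^ 2 = 1 := fun i =>
    topDet_sq_eq_one (hdn i).2.le hg hk (hkd i) (by
      rw [← castMatrix_mul, ← hgk]
      exact (congrArg Prod.snd (hred i)).symm)
  obtain ⟨N, hN, hNd⟩ := exists_lift_lowerLeftZero hp (Set.range d)
    (by rintro _ ⟨i, rfl⟩; exact hkd i) (by rintro _ ⟨i, rfl⟩; exact hsq i) (det_castMatrix k)
  have hN' : castMatrix (ZMod p) N = castMatrix (ZMod p) k := hN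
  have hmem : g' * N⁻¹ * g⁻¹ ∈ principalCongruenceSubgroup n p := by
    rw [castMatrix_eq_one_iff, castMatrix_mul, castMatrix_mul, castMatrix_inv N, hN',
      ← castMatrix_inv, ← castMatrix_mul, ← castMatrix_mul, ← castMatrix_one]
    congr 1
    simp [k]
  refine ⟨⟨_, hmem⟩, fun i => Subtype.ext ?_⟩
  have hNq : (stdSubspace ℚ n (d i)).map (toLin' (castMatrix ℚ N)) = stdSubspace ℚ n (d i) :=
    map_stdSubspace_of_lowerLeftZero (isUnit_det_castMatrix N) ((hNd _ ⟨i, rfl⟩).map _)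
  rw [congruenceAction_coe, hσ, hτ, ← map_toLin'_mul, ← castMatrix_mul, inv_mul_cancel_right]
  conv_lhs => rw [← hNq]
  rw [← map_toLin'_mul, ← castMatrix_mul, inv_mul_cancel_right]

theorem exists_reduceFlag_eq {j : ℕ}
    {c : Finset (Submodule (ZMod p) (Fin n → ZMod p) × ZMod p)}
    (hc : c ⊆ labelledInterval (squareLabels p) ⊥ ⊤)
    (hr : IsChain (labelledLT (ZMod p) (Fin n → ZMod p) (ZMod p))
      (↑c : Set (Submodule (ZMod p) (Fin n → ZMod p) × ZMod p))) (hj : c.card = j) :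
    ∃ σ : PosetFlag (TitsPoset ℚ (Fin n → ℚ)) j, reduceFlag p σ = c := by
  let f : Submodule (ZMod p) (Fin n → ZMod p) × ZMod p → ℕ := fun a => finrank (ZMod p) a.1
  have hf : ∀ {a b}, labelledLT _ _ _ a b → f a < f b := fun h =>
    Submodule.finrank_lt_finrank_of_lt h
  have hinj : Set.InjOn f c := fun a ha b hb h => by
    by_contra hab
    rcases hr ha hb hab with h' | h'
    · exact (hf h').ne h
    · exact (hf h').ne' h
  have hcard : (c.image f).card = j := by rw [Finset.card_image_of_injOn hinj, hj]
  -- The members of the chain are enumerated by increasing dimension.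
  let e := (c.image f).orderEmbOfFin hcard
  choose a hac hae using fun i => Finset.mem_image.1 ((c.image f).orderEmbOfFin_mem hcard i)
  have hae' : ∀ i, f (a i) = e i := hae
  have ha : ∀ i i', i < i' → labelledLT _ _ _ (a i) (a i') := fun i i' h => by
    have hlt : f (a i) < f (a i') := by rw [hae', hae']; exact e.strictMono h
    exact (hr (hac i) (hac i') fun h => hlt.ne (by rw [h])).resolve_right
      fun h => (hf h).not_gt hlt
  have hmem := fun i => mem_labelledInterval.1 (hc (hac i))
  obtain ⟨g, hg⟩ := exists_lift_labelled_flag (fun i => (a i).1) (fun i i' h => ha i i' h)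
    (fun i => (hmem i).1) (fun i => (a i).2) fun i => (hmem i).2
  have hgq := isUnit_det_castMatrix (R := ℚ) g
  have hd0 : ∀ i, 0 < f (a i) := fun i => by
    have := Submodule.finrank_lt_finrank_of_lt (hmem i).1.1
    rwa [finrank_bot] at this
  have hdn : ∀ i, f (a i) < n := fun i => by
    have := Submodule.finrank_lt_finrank_of_lt (hmem i).1.2
    rwa [finrank_top, finrank_fin_fun] at this
  let W : Fin j → TitsPoset ℚ (Fin n → ℚ) := fun i =>
    ⟨(stdSubspace ℚ n (f (a i))).map (toLin' (castMatrix ℚ g)),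
      (bot_lt_map_stdSubspace (hd0 i) (hdn i).le hgq).ne',
      (map_stdSubspace_lt_top (hdn i) hgq).ne⟩
  have hW : StrictMono W := fun i i' h => map_stdSubspace_lt (hf (ha i i' h)) (hdn i').le hgq
  have hred : ∀ i, reduceSubspace p (W i).1 = a i := fun i => by
    rw [reduceSubspace_map p (hdn i).le]
    exact Prod.ext (hg i).1 (hg i).2
  refine ⟨OrderEmbedding.ofStrictMono W hW, Finset.eq_of_subset_of_card_le (fun x hx => ?_) ?_⟩
  · obtain ⟨i, -, rfl⟩ := Finset.mem_image.1 hx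
    have := hred i
    exact this ▸ hac i
  · rw [card_reduceFlag, hj]

end QuotientFlags

/-! ### Comparing the quotient complex with the complex of labelled subspaces. -/

section QuotientHomology

open Module
open scoped Classical

variable {n p : ℕ} [Fact p.Prime]

variable (n p) in
/-- The chain of labelled subspaces that corresponds to an orbit of flags. -/
noncomputable def orbitChain (j : ℕ) (o : FlagOrbit (congruenceAction n p) j) :
    Finset (Submodule (ZMod p) (Fin n → ZMod p) × ZMod p) :=
  Quotient.lift (s := flagSetoid (congruenceAction n p) j) (reduceFlag p)
    (fun _ _ ⟨γ, h⟩ => reduceFlag_eq_of_rel γ h) o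

theorem orbitChain_injective (hp : 3 ≤ p) (j : ℕ) : Function.Injective (orbitChain n p j) := by
  intro o o' h
  induction o using Quotient.inductionOn with
  | h σ =>
    induction o' using Quotient.inductionOn with
    | h τ => exact Quotient.sound (exists_rel_of_reduceFlag_eq hp h)

theorem range_orbitChain (j : ℕ) : Set.range (orbitChain n p j) =
    {c | c ⊆ labelledInterval (squareLabels p) ⊥ ⊤ ∧
      IsChain (labelledLT (ZMod p) (Fin n → ZMod p) (ZMod p)) (c : Set _) ∧ c.card = j} := by
  ext c
  constructor
  · rintro ⟨o, rfl⟩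
    induction o using Quotient.inductionOn with
    | h σ => exact ⟨reduceFlag_subset σ, isChain_reduceFlag σ, card_reduceFlag σ⟩
  · rintro ⟨h1, h2, h3⟩
    obtain ⟨σ, hσ⟩ := exists_reduceFlag_eq h1 h2 h3
    exact ⟨Quotient.mk _ σ, hσ⟩

variable (n p) in
/-- The chains of the quotient complex, as chains on the labelled subspaces. -/
noncomputable def orbitChainMap (j : ℕ) : QuotientChain (congruenceAction n p) j →ₗ[ℤ]
    (Finset (Submodule (ZMod p) (Fin n → ZMod p) × ZMod p) →₀ ℤ) :=
  Finsupp.lmapDomain ℤ ℤ (orbitChain n p j)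

theorem orbitChainMap_single {j : ℕ} (o : FlagOrbit (congruenceAction n p) j) (a : ℤ) :
    orbitChainMap n p j (Finsupp.single o a) = Finsupp.single (orbitChain n p j o) a :=
  Finsupp.mapDomain_single

theorem orbitChainMap_injective (hp : 3 ≤ p) (j : ℕ) :
    Function.Injective (orbitChainMap n p j) :=
  Finsupp.mapDomain_injective (orbitChain_injective hp j)

theorem range_orbitChainMap (j : ℕ) : LinearMap.range (orbitChainMap n p j) =
    chainModule (labelledLT (ZMod p) (Fin n → ZMod p) (ZMod p))
      (labelledInterval (squareLabels p) ⊥ ⊤) j := by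
  rw [orbitChainMap, Finsupp.range_lmapDomain, chainModule_eq_span, ← range_orbitChain,
    ← Set.range_comp]
  rfl

theorem posSign_reduceSubspace {j : ℕ} (σ : PosetFlag (TitsPoset ℚ (Fin n → ℚ)) j) (i : Fin j) :
    posSign (labelledLT (ZMod p) (Fin n → ZMod p) (ZMod p)) (reduceSubspace p (σ i).1)
      (reduceFlag p σ) = (-1) ^ (i : ℕ) := by
  have : (reduceFlag p σ).filter (labelledLT (ZMod p) (Fin n → ZMod p) (ZMod p) ·
      (reduceSubspace p (σ i).1)) =
      (Finset.Iio i).image fun a => reduceSubspace p (σ a).1 := by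
    ext x
    simp only [reduceFlag, Finset.mem_filter, Finset.mem_image, Finset.mem_univ, true_and,
      Finset.mem_Iio]
    constructor
    · rintro ⟨⟨a, rfl⟩, h⟩
      refine ⟨a, lt_of_not_ge fun hia => ?_, rfl⟩
      rcases hia.eq_or_lt with rfl | hia
      · exact irrefl (r := labelledLT _ _ _) _ h
      · exact asymm (r := labelledLT _ _ _) h (reduceSubspace_lt σ hia)
    · rintro ⟨a, ha, rfl⟩
      exact ⟨⟨a, rfl⟩, reduceSubspace_lt σ ha⟩
  rw [posSign, this, Finset.card_image_of_injective _ (reduceSubspace_injective σ), Fin.card_Iio]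

theorem reduceFlag_face {j : ℕ} (σ : PosetFlag (TitsPoset ℚ (Fin n → ℚ)) (j + 1))
    (i : Fin (j + 1)) : reduceFlag p (PosetFlag.face i σ) =
      (reduceFlag p σ).erase (reduceSubspace p (σ i).1) := by
  ext x
  simp only [reduceFlag, Finset.mem_erase, Finset.mem_image, Finset.mem_univ, true_and]
  constructor
  · rintro ⟨a, rfl⟩
    exact ⟨fun h => Fin.succAbove_ne i a (reduceSubspace_injective (p := p) σ h),
      i.succAbove a, rfl⟩
  · rintro ⟨h, a, rfl⟩
    obtain ⟨b, rfl⟩ := Fin.exists_succAbove_eq (x := a) (y := i) fun e => h (by rw [e])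
    exact ⟨b, rfl⟩

theorem chainBoundary_orbitChainMap (j : ℕ) :
    chainBoundary (labelledLT (ZMod p) (Fin n → ZMod p) (ZMod p)) ∘ₗ orbitChainMap n p (j + 1) =
      orbitChainMap n p j ∘ₗ quotientBoundary (congruenceAction n p) j := by
  refine Finsupp.lhom_ext' fun o => LinearMap.ext_ring ?_
  simp only [LinearMap.comp_apply, Finsupp.lsingle_apply]
  rw [orbitChainMap_single, chainBoundary_single, quotientBoundary,
    Finsupp.linearCombination_single, one_smul, map_sum]
  simp_rw [orbitChainMap_single]
  induction o using Quotient.inductionOn with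
  | h σ =>
    change ∑ x ∈ Finset.univ.image (fun i => reduceSubspace p (σ i).1), Finsupp.single
        ((reduceFlag p σ).erase x) (posSign _ x (reduceFlag p σ)) =
      ∑ i, Finsupp.single (reduceFlag p (PosetFlag.face i σ)) ((-1 : ℤ) ^ (i : ℕ))
    rw [Finset.sum_image fun a _ b _ h => reduceSubspace_injective σ h]
    exact Finset.sum_congr rfl fun i _ => by rw [reduceFlag_face, posSign_reduceSubspace]

theorem map_quotientCycles (hp : 3 ≤ p) (j : ℕ) :
    (quotientCycles (congruenceAction n p) j).map (orbitChainMap n p j) =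
      chainCycles (labelledLT (ZMod p) (Fin n → ZMod p) (ZMod p))
        (labelledInterval (squareLabels p) ⊥ ⊤) j := by
  rw [chainCycles, ← range_orbitChainMap]
  rcases j with _ | j
  · rw [quotientCycles, Submodule.map_top, eq_comm, inf_eq_left, range_orbitChainMap]
    exact chainModule_le fun s _ _ h => by simp [Finset.card_eq_zero.1 h, chainBoundary_single]
  · have := chainBoundary_orbitChainMap (n := n) (p := p) j
    have hk : quotientCycles (congruenceAction n p) (j + 1) =
        (LinearMap.ker (chainBoundary (labelledLT (ZMod p) (Fin n → ZMod p) (ZMod p)))).comap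
          (orbitChainMap n p (j + 1)) := by
      rw [← LinearMap.ker_comp, this, LinearMap.ker_comp_of_ker_eq_bot _
        (LinearMap.ker_eq_bot.2 (orbitChainMap_injective hp j))]
      rfl
    rw [hk, Submodule.map_comap_eq]

theorem finrank_titsQuotientTopHomology (hp : 3 ≤ p) {m : ℕ} :
    finrank ℤ (TitsQuotientTopHomology (m + 1) p) =
      labelledRank (squareLabels p).card (fun k m => p ^ k * grassmannianCard p k m) m := by
  have hd : finrank (ZMod p) (⊤ : Submodule (ZMod p) (Fin (m + 1) → ZMod p)) =
      finrank (ZMod p) (⊥ : Submodule (ZMod p) (Fin (m + 1) → ZMod p)) + m + 1 := by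
    rw [finrank_top, finrank_bot, finrank_fin_fun, zero_add]
  have hS : (squareLabels p).Nonempty := Finset.card_pos.1 (by
    have := two_mul_card_squareLabels (p := p) hp
    omega)
  -- There are no simplices above the top degree, so top homology is the module of top cycles.
  have hempty : IsEmpty (FlagOrbit (congruenceAction (m + 1) p) (m + 1)) := ⟨fun o => by
    obtain ⟨h1, h2, h3⟩ := (range_orbitChain (n := m + 1) (p := p) (m + 1)).subset ⟨o, rfl⟩
    have := card_chain_le hd h1 h2
    omega⟩
  have hb : (LinearMap.range (quotientBoundary (congruenceAction (m + 1) p) m)).submoduleOf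
      (quotientCycles (congruenceAction (m + 1) p) m) = ⊥ := by
    have : LinearMap.range (quotientBoundary (congruenceAction (m + 1) p) m) = ⊥ := by
      rw [LinearMap.range_eq_bot]
      exact LinearMap.ext fun x => by rw [Subsingleton.elim x 0, map_zero, map_zero]
    rw [this, Submodule.submoduleOf, Submodule.comap_bot, Submodule.ker_subtype]
  have h : Spherical (labelledLT (ZMod p) (Fin (m + 1) → ZMod p) (ZMod p))
      (labelledInterval (squareLabels p) ⊥ ⊤) m
      (labelledRank (squareLabels p).card (fun k m => p ^ k * grassmannianCard p k m) m) := by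
    have h := spherical_labelledInterval hS m bot_le hd
    rw [Nat.card_zmod] at h
    convert h
    rfl
  replace h := h.finrank_chainCycles
  rw [← map_quotientCycles hp] at h
  have e := Submodule.equivMapOfInjective (orbitChainMap (m + 1) p m)
    (orbitChainMap_injective hp m) (quotientCycles (congruenceAction (m + 1) p) m)
  exact ((Submodule.quotEquivOfEqBot _ hb).trans e).finrank_eq.trans h

theorem grassmannianCard_self (m : ℕ) : grassmannianCard p m m = 1 := by
  rw [grassmannianCard, Nat.card_eq_one_iff_unique]
  refine ⟨⟨fun X Y => Subtype.ext ?_⟩, ⟨⟨⊤, by rw [finrank_top, finrank_fin_fun]⟩⟩⟩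
  have h : ∀ X : {W : Submodule (ZMod p) (Fin m → ZMod p) // finrank (ZMod p) W = m},
      X.1 = ⊤ := fun X => Submodule.eq_top_of_finrank_eq (by rw [X.2, finrank_fin_fun])
  rw [h, h]

end QuotientHomology

/-! ### The recursion for the ranks. -/

theorem theoremC (p : ℕ) [Fact p.Prime] (hp : 3 ≤ p) (t : ℕ → ℕ)
    (ht : ∀ n : ℕ, 1 ≤ n → t n = Module.finrank ℤ (TitsQuotientTopHomology n p)) :
    t 1 = 1 ∧
    ∀ n : ℕ, 2 ≤ n →
      (t n : ℚ) =
        (((p : ℚ) - 3) / 2 + ((p : ℚ) - 1) / 2 * (p : ℚ) ^ (n - 1)) * (t (n - 1) : ℚ) +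
        ((p : ℚ) - 1) * ((p : ℚ) - 3) / 4 *
          ∑ k ∈ Finset.Icc 1 (n - 2),
            (p : ℚ) ^ k * (grassmannianCard p k (n - 1) : ℚ) * (t k : ℚ) * (t (n - k - 1) : ℚ) := by
  -- Here `q` is one less than the number of labels, so `p = 2 * q + 3` and the truncated
  -- subtraction in `labelledRank` becomes exact.
  obtain ⟨q, hq⟩ : ∃ q, (squareLabels p).card = q + 1 :=
    Nat.exists_eq_add_one_of_ne_zero fun h => by
      have := two_mul_card_squareLabels (p := p) hp
      omega
  have ht' : ∀ m, t (m + 1) =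
      labelledRank (q + 1) (fun k m => p ^ k * grassmannianCard p k m) m := fun m => by
    rw [ht _ (Nat.le_add_left 1 m), finrank_titsQuotientTopHomology hp, hq]
  refine ⟨by rw [ht' 0, labelledRank], fun n hn => ?_⟩
  obtain ⟨m, rfl⟩ := Nat.exists_eq_add_of_le' hn
  have hpq : (p : ℚ) = 2 * q + 3 := by
    have h := two_mul_card_squareLabels (p := p) hp
    rw [hq] at h
    have h' : p = 2 * q + 3 := by omega
    exact_mod_cast h'
  have hsum : ∑ k ∈ Finset.Icc 1 m, (p : ℚ) ^ k * (grassmannianCard p k (m + 1) : ℚ) * (t k : ℚ) *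
        (t (m + 2 - k - 1) : ℚ) =
      ∑ k : Fin m, (p : ℚ) ^ (k + 1 : ℕ) * (grassmannianCard p (k + 1) (m + 1) : ℚ) *
        (t (k + 1) : ℚ) * (t (m - 1 - k + 1) : ℚ) := by
    rw [Finset.sum_fin_eq_sum_range, ← Finset.Ico_add_one_right_eq_Icc,
      Finset.sum_Ico_eq_sum_range, Nat.add_sub_cancel]
    refine Finset.sum_congr rfl fun k hk => ?_
    have hk := Finset.mem_range.1 hk
    rw [dif_pos hk, add_comm 1 k, show m + 2 - (k + 1) - 1 = m - 1 - k + 1 by omega]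
  -- `grassmannianCard_self` reduces the count of hyperplanes avoiding a line to `p ^ (m + 1)`, the
  -- separate last term of `labelledRank`.
  rw [show m + 2 - 2 = m from rfl, show m + 2 - 1 = m + 1 from rfl, hsum, ht' (m + 1),
    labelledRank, grassmannianCard_self]
  simp only [← ht', Nat.add_sub_cancel]
  push_cast
  rw [show ((p : ℚ) - 1) * (p - 3) / 4 = q * (q + 1) by rw [hpq]; ring, Finset.mul_sum,
    Finset.sum_congr rfl fun (k : Fin m) _ => show
      (p : ℚ) ^ (k + 1 : ℕ) * (grassmannianCard p (k + 1) (m + 1) : ℚ) *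
        ((q + 1) * (t (k + 1) * (q * t (m - 1 - k + 1)))) = q * (q + 1) *
      ((p : ℚ) ^ (k + 1 : ℕ) * (grassmannianCard p (k + 1) (m + 1) : ℚ) *
        (t (k + 1) : ℚ) * (t (m - 1 - k + 1) : ℚ)) by ring]
  rw [show ((p : ℚ) - 3) / 2 = q by rw [hpq]; ring,
    show ((p : ℚ) - 1) / 2 = q + 1 by rw [hpq]; ring]
  ring
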